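/- Let $K$ be a number field of degree $k=[K:\mathbb{Q}]$ with ring of integers $\mathfrak{o}$, let $\mathcal{P}_K$ be the set of non-zero prime ideals of $\mathfrak{o}$, and put $N(\mathfrak{p})=|\mathfrak{o}/\mathfrak{p}|$. For an integral basis $\mathbb{E}=\{e_1,\dots,e_k\}$ of $\mathfrak{o}$ and $H\in\mathbb{N}$ let $O(H,\mathbb{E})=\{\sum_{j=1}^k a_je_j : a_j\in[-H,H)\cap\mathbb{Z}\}$. A set $T\subseteq\mathfrak{o}^n$ is said to have density $\rho(T)$ if for every integral basis $\mathbb{E}$ the limit $$\lim_{H\to\infty}\frac{|T\cap O(H,\mathbb{E})^n|}{(2H)^{nk}}$$ exists and equals $\rho(T)$. A polynomial $f=a_0+a_1x+\dots+a_dx^d\in\mathfrak{o}[x]$ of degree $d$ (not necessarily monic) is $\mathfrak{p}$-Eisenstein if $a_d\notin\mathfrak{p}$, $a_i\in\mathfrak{p}$ for $0\le i\le d-1$, and $a_0\notin\mathfrak{p}^2$; it is shifted Eisenstein if there are $\mathfrak{p}\in\mathcal{P}_K$ and $b\in\mathfrak{o}$ such that $f(x+b)$ is $\mathfrak{p}$-Eisenstein.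 Let $\widetilde{\Gamma}^d\subseteq\mathfrak{o}^{d+1}$ be the set of coefficient tuples $(a_0,\dots,a_d)$ of shifted Eisenstein polynomials of degree $d$. Then for every integer $d\ge 2$ the product below converges unconditionally (its value may be $0$), the density of $\widetilde{\Gamma}^d$ exists, and $$\rho(\widetilde{\Gamma}^d)=1-\prod_{\mathfrak{p}\in\mathcal{P}_K}\left(1-\frac{(N(\mathfrak{p})-1)^2}{N(\mathfrak{p})^{d+1}}\right).$$ For $d=2$ this density is $1$. -/

import Mathlib

open Polynomial NumberField

namespace EisensteinDensity

/-- The box `O(H, 𝔼)` of a number field: the algebraic integers `∑ j, a j • e j` whose coordinates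
`a j` in the integral basis `𝔼 = {e 1, …, e k}` are integers in `[-H, H)`. -/
def box {K : Type*} [Field K] [NumberField K]
    (E : Module.Basis (Fin (Module.finrank ℚ K)) ℤ (𝓞 K)) (H : ℕ) : Set (𝓞 K) :=
  {x | ∀ j, E.repr x j ∈ Set.Ico (-(H : ℤ)) (H : ℤ)}

/-- `T ⊆ 𝔬 ^ n` has density `ρ` with respect to the integral basis `𝔼`:
`|T ∩ O(H, 𝔼) ^ n| / (2 H) ^ (n k) → ρ` as `H → ∞`, where `k = [K : ℚ]`. -/
def HasDensityWrt {K : Type*} [Field K] [NumberField K]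
    (E : Module.Basis (Fin (Module.finrank ℚ K)) ℤ (𝓞 K)) {n : ℕ}
    (T : Set (Fin n → 𝓞 K)) (ρ : ℝ) : Prop :=
  Filter.Tendsto
    (fun H : ℕ =>
      ((T ∩ {a | ∀ i, a i ∈ box E H}).ncard : ℝ) / (2 * (H : ℝ)) ^ (n * Module.finrank ℚ K))
    Filter.atTop (nhds ρ)

/-- `T ⊆ 𝔬 ^ n` has density `ρ`: the density with respect to every integral basis exists
and equals `ρ`. -/
def HasDensity {K : Type*} [Field K] [NumberField K] {n : ℕ}
    (T : Set (Fin n → 𝓞 K)) (ρ : ℝ) : Prop :=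
  ∀ E : Module.Basis (Fin (Module.finrank ℚ K)) ℤ (𝓞 K), HasDensityWrt E T ρ

/-- The polynomial `a 0 + a 1 X + ⋯ + a d X ^ d` represented by the tuple `(a 0, …, a d)`. -/
noncomputable def toPoly {R : Type*} [CommRing R] {d : ℕ} (a : Fin (d + 1) → R) : R[X] :=
  ∑ i, C (a i) * X ^ (i : ℕ)

/-- `f` is shifted `𝔭`-Eisenstein: `f (X + b)` is `𝔭`-Eisenstein for some `b`. -/
def IsShiftedEisensteinAt {R : Type*} [CommRing R] (f : R[X]) (P : Ideal R) : Prop :=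
  ∃ b : R, (f.comp (X + C b)).IsEisensteinAt P

/-- The set of (coefficient tuples of) shifted Eisenstein polynomials of degree `d`: those of degree
exactly `d` which are shifted `𝔭`-Eisenstein for some non-zero prime ideal `𝔭`. The leading
coefficient is not required to be `1`. -/
def shiftedEisenstein (K : Type*) [Field K] [NumberField K] (d : ℕ) :
    Set (Fin (d + 1) → 𝓞 K) :=
  {a | (toPoly a).natDegree = d ∧
    ∃ P : Ideal (𝓞 K), P.IsPrime ∧ P ≠ ⊥ ∧ IsShiftedEisensteinAt (toPoly a) P}

end EisensteinDensity

/-! Write `N` for the norm of a prime `P`. Being shifted `P`-Eisenstein depends only on the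
coefficients modulo `P ^ 2`, and the shift `b` only matters modulo `P`: for `d ≥ 2` a shift by an
element of `P` preserves the Eisenstein condition, and any other shift destroys it. Hence the local
set is a disjoint union of `N` translates of the Eisenstein tuples (`ncard_localSet`), which gives
the local density `N * (N ^ 2 - N) * N ^ (d - 1) * (N - 1) / N ^ (2 * (d + 1)) = (N - 1) ^ 2 / N ^
(d + 1)`. For finitely many primes, the Chinese remainder theorem and equidistribution of boxes
modulo an ideal give the finite product (`hasDensityWrt_forall_notMem_localSet`).

Passing to all primes needs a uniform tail bound when `d ≥ 3` (`exists_eventually_card_le`). Modulo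
`P` a shifted Eisenstein polynomial is `u * (X + c) ^ d`, so at most `N ^ 2` residue tuples occur.
If `P` contains a positive integer `≤ 2 * H`, boxes are well distributed modulo `P` up to a
constant, and `P` contributes a proportion `O(N ^ (1 - d))`, hence `O(1 / N ^ 2)`, which is
summable. For the remaining, large primes, eliminating `u` and `c` shows that `F = (d - 1) * a_{d-1}
^ 2 - 2 * d * a_d * a_{d-2}` lies in `P`. If `F ≠ 0`, its norm is too small for more than `2 * k +
1` large primes to divide it, and each of them fixes `a_0` modulo `P` in terms of the other
coefficients; if `F = 0`, then `a_{d-2}` is determined. Either way the proportion is `O(1 / H)`.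
Since `d ≥ 3`, `F` does not involve `a_0`.

For `d = 2` no tail bound is needed: `∑ 1 / N` diverges because the Dedekind zeta function has a
pole at `1`, so the product is `0` (`tprod_factor_two`) and the finite lower bounds already tend to
`1`. -/

namespace EisensteinDensity

/-! ### Translation of the variable and the local count modulo `P ^ 2`. -/

section Local

variable {R S : Type*} [CommRing R] [CommRing S] {d : ℕ}

theorem coeff_toPoly (a : Fin (d + 1) → R) (i : Fin (d + 1)) : (toPoly a).coeff i = a i := by
  simp [toPoly, coeff_X_pow, Fin.val_inj]

theorem coeff_toPoly_of_lt (a : Fin (d + 1) → R) {n : ℕ} (hn : d < n) :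
    (toPoly a).coeff n = 0 := by
  simp only [toPoly, finsetSum_coeff, coeff_C_mul, coeff_X_pow]
  exact Finset.sum_eq_zero fun i _ => by rw [if_neg (by omega), mul_zero]

theorem natDegree_toPoly_le (a : Fin (d + 1) → R) : (toPoly a).natDegree ≤ d :=
  natDegree_le_iff_coeff_eq_zero.2 fun _ hn => coeff_toPoly_of_lt a hn

theorem toPoly_coeff {f : R[X]} (hf : f.natDegree ≤ d) :
    toPoly (fun i : Fin (d + 1) => f.coeff i) = f := by
  ext n
  rcases le_or_gt n d with h | h
  · exact coeff_toPoly (fun i : Fin (d + 1) => f.coeff i) ⟨n, by omega⟩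
  · rw [coeff_toPoly_of_lt _ h, coeff_eq_zero_of_natDegree_lt (by omega)]

theorem map_toPoly (φ : R →+* S) (a : Fin (d + 1) → R) :
    (toPoly a).map φ = toPoly (φ ∘ a) := by
  simp [toPoly, Polynomial.map_sum]

theorem eval_toPoly (a : Fin (d + 1) → R) (c : R) :
    (toPoly a).eval c = ∑ i, a i * c ^ (i : ℕ) := by
  simp [toPoly, eval_finsetSum]

/-- The coefficient tuple of `f (X + b)`, where `f` has coefficient tuple `a`. -/
noncomputable def translate (b : R) (a : Fin (d + 1) → R) : Fin (d + 1) → R :=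
  fun i => (taylor b (toPoly a)).coeff i

theorem toPoly_translate (b : R) (a : Fin (d + 1) → R) :
    toPoly (translate b a) = taylor b (toPoly a) :=
  toPoly_coeff (by rw [natDegree_taylor]; exact natDegree_toPoly_le a)

theorem translate_translate (b c : R) (a : Fin (d + 1) → R) :
    translate b (translate c a) = translate (b + c) a := by
  funext i
  rw [translate, toPoly_translate, taylor_taylor, translate]

theorem translate_zero (a : Fin (d + 1) → R) : translate 0 a = a := by
  funext i
  simp [translate, coeff_toPoly]

theorem map_translate (φ : R →+* S) (b : R) (a : Fin (d + 1) → R) :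
    φ ∘ translate b a = translate (φ b) (φ ∘ a) := by
  funext i
  simp only [translate, Function.comp_apply]
  rw [← map_toPoly, ← map_taylor, coeff_map]

/-- Translation of the variable by `b`, as a permutation of the coefficient tuples. -/
noncomputable def translateEquiv (b : R) : (Fin (d + 1) → R) ≃ (Fin (d + 1) → R) where
  toFun := translate b
  invFun := translate (-b)
  left_inv a := by rw [translate_translate, neg_add_cancel, translate_zero]
  right_inv a := by rw [translate_translate, add_neg_cancel, translate_zero]

theorem translate_last (b : R) (a : Fin (d + 1) → R) :
    translate b a (Fin.last d) = a (Fin.last d) := by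
  simp only [translate, taylor_coeff, Fin.val_last]
  rw [← coeff_toPoly a (Fin.last d), Fin.val_last]
  have : hasseDeriv d (toPoly a) = C ((toPoly a).coeff d) := by
    ext n
    rw [hasseDeriv_coeff, coeff_C]
    split_ifs with h
    · simp [h]
    · rw [coeff_toPoly_of_lt a (by omega), mul_zero]
  rw [this, eval_C]

theorem translate_apply_zero (b : R) (a : Fin (d + 1) → R) :
    translate b a 0 = ∑ i, a i * b ^ (i : ℕ) := by
  simp [translate, eval_toPoly]

/-- The tuple `(a 0, …, a d)` satisfies the Eisenstein condition at `P`. -/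
def EisTuple (P : Ideal R) (a : Fin (d + 1) → R) : Prop :=
  a (Fin.last d) ∉ P ∧ (∀ i : Fin d, a i.castSucc ∈ P) ∧ a 0 ∉ P ^ 2

/-- The coefficient tuples of the shifted `P`-Eisenstein polynomials. -/
def localSet (d : ℕ) (P : Ideal R) : Set (Fin (d + 1) → R) :=
  {a | ∃ b, EisTuple P (translate b a)}

theorem isEisensteinAt_toPoly_iff {P : Ideal R} {a : Fin (d + 1) → R}
    (h : (toPoly a).natDegree = d) : (toPoly a).IsEisensteinAt P ↔ EisTuple P a := by
  have h0 : (toPoly a).coeff 0 = a 0 := coeff_toPoly a 0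
  have hl : (toPoly a).leadingCoeff = a (Fin.last d) := by
    rw [leadingCoeff, h]; exact coeff_toPoly a (Fin.last d)
  constructor
  · intro H
    refine ⟨hl ▸ H.leading, fun i => ?_, h0 ▸ H.notMem⟩
    rw [← coeff_toPoly a i.castSucc]
    exact H.mem (by simp [h])
  · rintro ⟨h1, h2, h3⟩
    refine ⟨hl ▸ h1, fun {n} hn => ?_, h0 ▸ h3⟩
    rw [h] at hn
    have := h2 ⟨n, hn⟩
    rwa [← coeff_toPoly a] at this

theorem mem_localSet_iff {P : Ideal R} {a : Fin (d + 1) → R} :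
    a ∈ localSet d P ↔ (toPoly a).natDegree = d ∧ IsShiftedEisensteinAt (toPoly a) P := by
  have key (b : R) (h : (toPoly a).natDegree = d) :
      ((toPoly a).comp (X + C b)).IsEisensteinAt P ↔ EisTuple P (translate b a) := by
    rw [← isEisensteinAt_toPoly_iff, toPoly_translate, taylor_apply]
    rw [toPoly_translate, natDegree_taylor, h]
  constructor
  · rintro ⟨b, hb⟩
    have h : (toPoly a).natDegree = d := by
      refine le_antisymm (natDegree_toPoly_le a) (le_natDegree_of_ne_zero fun h0 => hb.1 ?_)
      rw [translate_last, ← coeff_toPoly a (Fin.last d), Fin.val_last, h0]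
      exact P.zero_mem
    exact ⟨h, b, (key b h).2 hb⟩
  · rintro ⟨h, b, hb⟩
    exact ⟨b, (key b h).1 hb⟩

theorem shiftedEisenstein_eq (K : Type*) [Field K] [NumberField K] (d : ℕ) :
    shiftedEisenstein K d =
      ⋃ P : IsDedekindDomain.HeightOneSpectrum (𝓞 K), localSet d P.asIdeal := by
  ext a
  simp only [shiftedEisenstein, Set.mem_ofPred_eq, Set.mem_iUnion, mem_localSet_iff]
  constructor
  · rintro ⟨h, P, h1, h2, h3⟩
    exact ⟨⟨P, h1, h2⟩, h, h3⟩
  · rintro ⟨P, h, h3⟩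
    exact ⟨h, P.asIdeal, P.isPrime, P.ne_bot, h3⟩

theorem mem_map_of_ker_le {φ : R →+* S} (hφ : Function.Surjective φ) {I : Ideal R}
    (hI : RingHom.ker φ ≤ I) {x : R} : φ x ∈ I.map φ ↔ x ∈ I := by
  rw [← Ideal.mem_comap, Ideal.comap_map_of_surjective' φ hφ, sup_eq_left.2 hI]

/-- The Eisenstein condition tests membership in `P` and `P ^ 2` only, so it can be read off modulo
any ideal inside `P ^ 2`. -/
theorem comp_mem_localSet_iff {φ : R →+* S} (hφ : Function.Surjective φ) {P : Ideal R}
    (hP : RingHom.ker φ ≤ P ^ 2) {a : Fin (d + 1) → R} :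
    φ ∘ a ∈ localSet d (P.map φ) ↔ a ∈ localSet d P := by
  have hP1 : RingHom.ker φ ≤ P := hP.trans (Ideal.pow_le_self two_ne_zero)
  have key (b : R) : EisTuple (P.map φ) (translate (φ b) (φ ∘ a)) ↔ EisTuple P (translate b a) := by
    rw [← map_translate]
    simp only [EisTuple, Function.comp_apply, ← Ideal.map_pow, mem_map_of_ker_le hφ hP,
      mem_map_of_ker_le hφ hP1]
  constructor
  · rintro ⟨b, hb⟩
    obtain ⟨b, rfl⟩ := hφ b
    exact ⟨b, (key b).1 hb⟩
  · rintro ⟨b, hb⟩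
    exact ⟨φ b, (key b).2 hb⟩

/-- Modulo `P` the polynomial is `a_d * X ^ d`, and its value at `c` is the new constant term; this
forces `c ^ d ∈ P`. It makes translates for different classes of `b` disjoint. -/
theorem EisTuple.mem_of_translate {P : Ideal R} [hP : P.IsPrime] (hd : 1 ≤ d)
    {a : Fin (d + 1) → R} {c : R} (ha : EisTuple P a) (hc : EisTuple P (translate c a)) :
    c ∈ P := by
  have h0 : translate c a 0 ∈ P := by
    have := hc.2.1 ⟨0, hd⟩
    simpa using this
  rw [translate_apply_zero, Fin.sum_univ_castSucc] at h0
  have h1 := (P.add_mem_iff_right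
    (P.sum_mem fun i _ => P.mul_mem_right _ (ha.2.1 i))).1 h0
  exact hP.mem_of_pow_mem _ ((hP.mem_or_mem h1).resolve_left ha.1)

/-- The constant term changes by `∑ a_i * c ^ i` over `i ≥ 1`: for `i < d` both factors lie in `P`,
and for `i = d` the power `c ^ d` lies in `P ^ 2` because `d ≥ 2`. -/
theorem EisTuple.translate {P : Ideal R} (hd : 2 ≤ d)
    {a : Fin (d + 1) → R} {c : R} (ha : EisTuple P a) (hc : c ∈ P) :
    EisTuple P (translate c a) := by
  refine ⟨by rw [translate_last]; exact ha.1, fun i => ?_, ?_⟩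
  · have h := congrFun (map_translate (Ideal.Quotient.mk P) c a) i.castSucc
    rw [Ideal.Quotient.eq_zero_iff_mem.2 hc, translate_zero] at h
    rw [← Ideal.Quotient.eq_zero_iff_mem]
    exact h.trans (Ideal.Quotient.eq_zero_iff_mem.2 (ha.2.1 i))
  · rw [translate_apply_zero, Fin.sum_univ_succ]
    simp only [Fin.val_zero, pow_zero, mul_one, Fin.val_succ]
    rw [Ideal.add_mem_iff_left]
    · exact ha.2.2
    · refine Ideal.sum_mem _ fun i _ => ?_
      rcases Nat.lt_or_ge (i + 1 : ℕ) d with hi | hi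
      · rw [pow_succ' c, sq, ← mul_assoc]
        refine Ideal.mul_mem_right _ _ (Ideal.mul_mem_mul ?_ hc)
        have := ha.2.1 ⟨i + 1, hi⟩
        exact this
      · refine Ideal.mul_mem_left _ _ (Ideal.pow_le_pow_right (by omega) (Ideal.pow_mem_pow hc _))

theorem ncard_eisTuple [Finite S] {P : Ideal S} (hP : P ^ 2 = ⊥) (hd : 1 ≤ d) :
    {a : Fin (d + 1) → S | EisTuple P a}.ncard =
      (Nat.card S - Nat.card P) * Nat.card P ^ (d - 1) * (Nat.card P - 1) := by
  classical
  obtain ⟨e, rfl⟩ : ∃ e, d = e + 1 := ⟨d - 1, by omega⟩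
  have : Fintype S := Fintype.ofFinite S
  let t : Fin (e + 2) → Finset S := Fin.cons (Finset.univ.filter fun x => x ∈ P ∧ x ≠ 0)
    (Fin.snoc (fun _ => Finset.univ.filter fun x => x ∈ P)
      (Finset.univ.filter fun x => x ∉ P) : Fin (e + 1) → Finset S)
  have h : {a : Fin (e + 1 + 1) → S | EisTuple P a} = (Fintype.piFinset t : Set _) := by
    ext a
    simp only [Set.mem_ofPred_eq, EisTuple, Finset.mem_coe, Fintype.mem_piFinset, hP, Ideal.mem_bot]
    rw [Fin.forall_fin_succ (P := fun i => a i ∈ t i), Fin.forall_fin_succ,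
      Fin.forall_fin_succ' (P := fun i => a i.succ ∈ t i.succ)]
    simp only [← Fin.succ_castSucc, t, Fin.cons_zero, Fin.cons_succ, Fin.snoc_castSucc,
      Fin.snoc_last, Finset.mem_filter, Finset.mem_univ, true_and, ← Fin.succ_last,
      Fin.castSucc_zero]
    tauto
  have hc : (Finset.univ.filter (fun x : S => x ∈ P)).card = Nat.card P := by
    rw [← Fintype.card_subtype, Nat.card_eq_fintype_card]
  rw [h, Set.ncard_coe_finset, Fintype.card_piFinset, Fin.prod_univ_succ, Fin.prod_univ_castSucc]
  simp only [t, Fin.cons_zero, Fin.cons_succ, Fin.snoc_castSucc, Fin.snoc_last, Finset.prod_const,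
    Finset.card_univ, Fintype.card_fin, hc]
  have h1 : (Finset.univ.filter fun x : S => x ∈ P ∧ x ≠ 0).card = Nat.card P - 1 := by
    rw [← hc, ← Finset.card_erase_of_mem (a := (0 : S)) (by simp)]
    congr 1
    ext x
    simp [and_comm]
  have h2 : (Finset.univ.filter fun x : S => x ∉ P).card = Nat.card S - Nat.card P := by
    rw [← Finset.compl_filter, Finset.card_compl, hc, Nat.card_eq_fintype_card (α := S)]
  rw [h1, h2, Nat.add_sub_cancel]
  ring

/-- One translate of the Eisenstein tuples for each class of `b` modulo `P`; the translates are
disjoint and equinumerous. -/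
theorem ncard_localSet [Finite S] {P : Ideal S} [P.IsPrime] (hP : P ^ 2 = ⊥) (hd : 2 ≤ d) :
    (localSet d P).ncard = Nat.card (S ⧸ P) *
      ((Nat.card S - Nat.card P) * Nat.card P ^ (d - 1) * (Nat.card P - 1)) := by
  classical
  have : Fintype S := Fintype.ofFinite S
  have : Finite (S ⧸ P) := Finite.of_surjective _ Ideal.Quotient.mk_surjective
  have : Fintype (S ⧸ P) := Fintype.ofFinite _
  have h : localSet d P = ((Finset.univ : Finset (S ⧸ P)).biUnion fun y =>
      {a : Fin (d + 1) → S | EisTuple P (translate y.out a)} : Finset _) := by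
    ext a
    simp only [localSet, Set.mem_ofPred_eq, Finset.coe_biUnion, Finset.coe_univ, Set.mem_univ,
      Set.iUnion_true, Set.mem_iUnion, Finset.coe_filter, Finset.mem_univ, true_and]
    refine ⟨fun ⟨b, hb⟩ => ⟨Ideal.Quotient.mk P b, ?_⟩, fun ⟨y, hy⟩ => ⟨_, hy⟩⟩
    have hm : (Ideal.Quotient.mk P b).out - b ∈ P := by
      rw [← Ideal.Quotient.eq]; exact Quotient.out_eq' _
    have := hb.translate hd hm
    rwa [translate_translate, sub_add_cancel] at this
  rw [h, Set.ncard_coe_finset, Finset.card_biUnion]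
  · rw [← ncard_eisTuple hP (by omega),
      Finset.sum_const_nat (m := {a : Fin (d + 1) → S | EisTuple P a}.ncard), Finset.card_univ,
      Nat.card_eq_fintype_card]
    intro y _
    have : ((Finset.univ.filter fun a : Fin (d + 1) → S => EisTuple P (translate y.out a) :
        Finset _) : Set _) = translateEquiv (d := d) y.out ⁻¹' {a | EisTuple P a} := by
      ext a
      simp [translateEquiv]
    rw [← Set.ncard_coe_finset, this]
    change Set.ncard (translateEquiv (d := d) y.out ⁻¹' {a | EisTuple P a}) = _
    exact Set.ncard_preimage_of_injective_subset_range (s := {a | EisTuple P a})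
      (translateEquiv (d := d) y.out).injective (by simp)
  · intro y _ z _ hyz
    rw [Function.onFun, Finset.disjoint_left]
    intro a ha hb
    simp only [Finset.mem_filter, Finset.mem_univ, true_and] at ha hb
    apply hyz
    have hb' : EisTuple P (translate (z.out - y.out) (translate y.out a)) := by
      rwa [translate_translate, sub_add_cancel]
    have := ha.mem_of_translate (by omega) hb'
    rw [← Ideal.Quotient.eq] at this
    simpa using this.symm

/-- Undoing the shift turns `u * X ^ d` modulo `P` into `u * (X + c) ^ d` with `c = -b`. The tail
estimates use only this consequence. -/
theorem exists_of_mem_localSet {P : Ideal R} {a : Fin (d + 1) → R} (ha : a ∈ localSet d P) :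
    ∃ u c : R, u ∉ P ∧ ∀ i : Fin (d + 1), a i - u * (d.choose i * c ^ (d - i : ℕ)) ∈ P := by
  obtain ⟨b, hb⟩ := ha
  refine ⟨translate b a (Fin.last d), -b, hb.1, fun i => ?_⟩
  have hg : toPoly (Ideal.Quotient.mk P ∘ translate b a) =
      C (Ideal.Quotient.mk P (translate b a (Fin.last d))) * X ^ d := by
    rw [toPoly, Fin.sum_univ_castSucc, Finset.sum_eq_zero, zero_add]
    · simp
    · intro i _
      simp [Ideal.Quotient.eq_zero_iff_mem.2 (hb.2.1 i)]
  have h := congrFun (map_translate (Ideal.Quotient.mk P) (-b) (translate b a)) i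
  rw [translate_translate, neg_add_cancel, translate_zero] at h
  rw [← Ideal.Quotient.eq]
  refine h.trans ?_
  rw [EisensteinDensity.translate, hg, taylor_mul, taylor_C, taylor_X_pow, coeff_C_mul,
    coeff_X_add_C_pow]
  simp [mul_comm]

end Local

/-! ### Equidistribution of boxes modulo ideals. -/

section Box

open Finset

theorem le_card_Ico_filter_cast_eq {q : ℕ} [NeZero q] (H : ℕ) (v : ZMod q) :
    2 * H / q ≤ #{t ∈ Ico (-(H : ℤ)) H | ((t : ℤ) : ZMod q) = v} ∧
      #{t ∈ Ico (-(H : ℤ)) H | ((t : ℤ) : ZMod q) = v} ≤ 2 * H / q + 1 := by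
  have hq : 0 < q := NeZero.pos q
  have h : ∀ t : ℤ, ((t : ℤ) : ZMod q) = v ↔ t ≡ (v.val : ℤ) [ZMOD q] := fun t => by
    rw [← ZMod.intCast_eq_intCast_iff]; simp
  simp only [h]
  have hc := Int.Ico_filter_modEq_card (-(H : ℤ)) H (r := q) (by exact_mod_cast hq) v.val
  set c := #{t ∈ Ico (-(H : ℤ)) H | t ≡ (v.val : ℤ) [ZMOD q]} with hcdef
  set w : ℤ := (v.val : ℤ)
  have hQ : (0 : ℚ) < q := by exact_mod_cast hq
  push_cast at hc
  set A := ⌈((H : ℚ) - w) / q⌉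
  set B := ⌈(-(H : ℚ) - w) / q⌉
  have hA1 := Int.le_ceil (((H : ℚ) - w) / q)
  have hA2 := Int.ceil_lt_add_one (((H : ℚ) - w) / q)
  have hB1 := Int.le_ceil ((-(H : ℚ) - w) / q)
  have hB2 := Int.ceil_lt_add_one ((-(H : ℚ) - w) / q)
  have hdiff : ((H : ℚ) - w) / q - (-(H : ℚ) - w) / q = 2 * H / q := by ring
  have hn0 : ((2 * H / q : ℕ) : ℚ) ≤ 2 * H / q := by
    have := @Nat.cast_div_le ℚ _ _ _ (2 * H) q
    push_cast at this ⊢; exact this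
  have hn1 : (2 * H / q : ℚ) < ((2 * H / q : ℕ) : ℚ) + 1 := by
    rw [div_lt_iff₀ hQ]
    have := Nat.lt_mul_div_succ (2 * H) hq
    have h2 : ((2 * H : ℕ) : ℚ) < ((q * (2 * H / q + 1) : ℕ) : ℚ) := by exact_mod_cast this
    push_cast at h2 ⊢; linarith
  generalize 2 * H / q = m at *
  have h1 : (m : ℤ) < A - B + 1 := by
    have : ((m : ℤ) : ℚ) < ((A - B + 1 : ℤ) : ℚ) := by
      push_cast at *; linarith
    exact_mod_cast this
  have h2 : A - B < (m : ℤ) + 2 := by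
    have : ((A - B : ℤ) : ℚ) < (((m : ℤ) + 2 : ℤ) : ℚ) := by
      push_cast at *; linarith
    exact_mod_cast this
  omega

variable {K : Type*} [Field K] [NumberField K]
  (E : Module.Basis (Fin (Module.finrank ℚ K)) ℤ (𝓞 K))

/-- The coordinate description of `box E H`, as a finite set. -/
noncomputable def boxFinset (H : ℕ) : Finset (𝓞 K) :=
  (Fintype.piFinset fun _ => Ico (-(H : ℤ)) H).map E.equivFun.symm.toEquiv.toEmbedding

variable {E}

theorem mem_boxFinset {H : ℕ} {x : 𝓞 K} :
    x ∈ boxFinset E H ↔ ∀ j, E.repr x j ∈ Set.Ico (-(H : ℤ)) H := by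
  rw [boxFinset, Finset.mem_map_equiv, Fintype.mem_piFinset]
  simp [Module.Basis.equivFun_apply]

theorem coe_boxFinset (H : ℕ) : (boxFinset E H : Set (𝓞 K)) = box E H := by
  ext x
  exact mem_boxFinset

theorem card_boxFinset (H : ℕ) : #(boxFinset E H) = (2 * H) ^ Module.finrank ℚ K := by
  rw [boxFinset, card_map, Fintype.card_piFinset, prod_const, card_univ, Fintype.card_fin,
    Int.card_Ico]
  congr 1
  omega

theorem card_boxFinset_filter {q : ℕ} [NeZero q] (H : ℕ)
    (v : Fin (Module.finrank ℚ K) → ZMod q) :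
    (2 * H / q) ^ Module.finrank ℚ K ≤
        #{x ∈ boxFinset E H | (fun j => ((E.repr x j : ℤ) : ZMod q)) = v} ∧
      #{x ∈ boxFinset E H | (fun j => ((E.repr x j : ℤ) : ZMod q)) = v} ≤
        (2 * H / q + 1) ^ Module.finrank ℚ K := by
  have h : #{x ∈ boxFinset E H | (fun j => ((E.repr x j : ℤ) : ZMod q)) = v} =
      ∏ j, #{t ∈ Ico (-(H : ℤ)) H | ((t : ℤ) : ZMod q) = v j} := by
    rw [← Fintype.card_piFinset, boxFinset, filter_map, card_map]
    congr 1
    ext y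
    simp [funext_iff, forall_and, Module.Basis.equivFun]
  rw [h]
  constructor
  · calc _ = ∏ _j : Fin (Module.finrank ℚ K), (2 * H / q) := by simp
      _ ≤ _ := prod_le_prod' fun j _ => (le_card_Ico_filter_cast_eq H (v j)).1
  · calc _ ≤ ∏ _j : Fin (Module.finrank ℚ K), (2 * H / q + 1) :=
          prod_le_prod' fun j _ => (le_card_Ico_filter_cast_eq H (v j)).2
      _ = _ := by simp

/-- If the integer `q` lies in the ideal `M`, the residue class modulo `M` of an algebraic integer
is determined by its coordinates modulo `q`. -/
theorem exists_addMonoidHom_zmod (E : Module.Basis (Fin (Module.finrank ℚ K)) ℤ (𝓞 K))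
    {q : ℕ} {M : Ideal (𝓞 K)} (hM : (q : 𝓞 K) ∈ M) :
    ∃ φ : (Fin (Module.finrank ℚ K) → ZMod q) →+ 𝓞 K ⧸ M,
      ∀ x, φ (fun j => ((E.repr x j : ℤ) : ZMod q)) = Ideal.Quotient.mk M x := by
  have hq : ∀ a : 𝓞 K ⧸ M, zmultiplesHom _ a (q : ℤ) = 0 := fun a => by
    obtain ⟨a, rfl⟩ := Ideal.Quotient.mk_surjective a
    rw [zmultiplesHom_apply, natCast_zsmul, ← map_nsmul, Ideal.Quotient.eq_zero_iff_mem,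
      nsmul_eq_mul]
    exact M.mul_mem_right _ hM
  refine ⟨∑ j, (ZMod.lift q ⟨zmultiplesHom _ (Ideal.Quotient.mk M (E j)), hq _⟩).comp
    (Pi.evalAddMonoidHom _ j), fun x => ?_⟩
  conv_rhs => rw [← E.sum_repr x, map_sum]
  simp [AddMonoidHom.finsetSum_apply]

open Classical in
-- Coordinate vectors modulo `q` surject additively onto the residue classes, so all fibres have the
-- same size `q ^ k / N(M)`. The integer `q` is kept free: the limit takes `q = N(M)`, while the
-- tail bound needs some `q ≤ 2 * H`.
theorem card_boxFinset_filter_mk {q : ℕ} (hq : 0 < q) {M : Ideal (𝓞 K)} (hM : (q : 𝓞 K) ∈ M)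
    (H : ℕ) (r : 𝓞 K ⧸ M) :
    (2 * H / q * q) ^ Module.finrank ℚ K ≤
        Ideal.absNorm M * #{x ∈ boxFinset E H | Ideal.Quotient.mk M x = r} ∧
      Ideal.absNorm M * #{x ∈ boxFinset E H | Ideal.Quotient.mk M x = r} ≤
        ((2 * H / q + 1) * q) ^ Module.finrank ℚ K := by
  have : NeZero q := ⟨hq.ne'⟩
  obtain ⟨φ, hφ⟩ := exists_addMonoidHom_zmod E hM
  have hs : Function.Surjective φ := fun y => by
    obtain ⟨x, rfl⟩ := Ideal.Quotient.mk_surjective y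
    exact ⟨_, hφ x⟩
  have : Finite (𝓞 K ⧸ M) := Finite.of_surjective _ hs
  have : Fintype (𝓞 K ⧸ M) := Fintype.ofFinite _
  have hfib : Ideal.absNorm M * #{v | φ v = r} = q ^ Module.finrank ℚ K := by
    have h1 : ∑ y : 𝓞 K ⧸ M, #{v | φ v = y} = q ^ Module.finrank ℚ K := by
      have h := card_eq_sum_card_fiberwise (f := φ) (s := univ) (t := univ)
        (fun _ _ => mem_coe.2 (mem_univ _))
      rw [← h, card_univ]
      simp [ZMod.card]
    rw [← h1, sum_const_nat (m := #{v | φ v = r}), card_univ, Ideal.absNorm_apply,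
      Submodule.cardQuot_apply, Nat.card_eq_fintype_card]
    intro y _
    exact AddMonoidHom.card_fiber_eq_of_mem_range φ (hs y) (hs r)
  have hcount : #{x ∈ boxFinset E H | Ideal.Quotient.mk M x = r} =
      ∑ v with φ v = r, #{x ∈ boxFinset E H | (fun j => ((E.repr x j : ℤ) : ZMod q)) = v} := by
    rw [card_eq_sum_card_fiberwise (f := fun x j => ((E.repr x j : ℤ) : ZMod q))
      (t := {v | φ v = r})]
    · refine sum_congr rfl fun v hv => ?_
      congr 1
      ext x
      simp only [mem_filter, mem_univ, true_and] at hv ⊢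
      refine ⟨fun h => ⟨h.1.1, h.2⟩, fun h => ⟨⟨h.1, ?_⟩, h.2⟩⟩
      rw [← hφ, h.2, hv]
    · intro x hx
      simp only [coe_filter, mem_univ, true_and, Set.mem_ofPred_eq, hφ] at hx ⊢
      exact hx.2
  rw [hcount, mul_pow, mul_pow, ← hfib]
  constructor
  · calc _ = Ideal.absNorm M * ∑ v with φ v = r, (2 * H / q) ^ Module.finrank ℚ K := by
          rw [sum_const, smul_eq_mul]; ring
      _ ≤ _ := Nat.mul_le_mul_left _ (sum_le_sum fun v _ => (card_boxFinset_filter H v).1)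
  · calc _ ≤ Ideal.absNorm M * ∑ v with φ v = r, (2 * H / q + 1) ^ Module.finrank ℚ K :=
          Nat.mul_le_mul_left _ (sum_le_sum fun v _ => (card_boxFinset_filter H v).2)
      _ = _ := by rw [sum_const, smul_eq_mul]; ring

open Filter Topology in
theorem tendsto_div_mul_div (q : ℕ) (hq : 0 < q) :
    Tendsto (fun H : ℕ => ((2 * H / q * q : ℕ) : ℝ) / (2 * H)) atTop (𝓝 1) ∧
      Tendsto (fun H : ℕ => (((2 * H / q + 1) * q : ℕ) : ℝ) / (2 * H)) atTop (𝓝 1) := by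
  have h0 : Tendsto (fun H : ℕ => (q : ℝ) / (2 * H)) atTop (𝓝 0) :=
    tendsto_const_nhds.div_atTop
      (tendsto_natCast_atTop_atTop.const_mul_atTop (by norm_num : (0 : ℝ) < 2))
  have h1 : Tendsto (fun H : ℕ => 1 - (q : ℝ) / (2 * H)) atTop (𝓝 1) := by
    simpa using tendsto_const_nhds.sub h0
  have h2 : Tendsto (fun H : ℕ => 1 + (q : ℝ) / (2 * H)) atTop (𝓝 1) := by
    simpa using tendsto_const_nhds.add h0
  have key : ∀ H : ℕ, 0 < H → (2 * H : ℝ) < ((2 * H / q + 1) * q : ℕ) ∧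
      ((2 * H / q * q : ℕ) : ℝ) ≤ 2 * H := fun H _ => by
    have a := Nat.lt_mul_div_succ (2 * H) hq
    rw [mul_comm q] at a
    exact ⟨by exact_mod_cast a, by exact_mod_cast Nat.div_mul_le_self (2 * H) q⟩
  have e : ∀ H : ℕ, (((2 * H / q + 1) * q : ℕ) : ℝ) = ((2 * H / q * q : ℕ) : ℝ) + q := fun H => by
    push_cast; ring
  constructor
  · refine tendsto_of_tendsto_of_tendsto_of_le_of_le' h1 tendsto_const_nhds ?_ ?_ <;>
      filter_upwards [eventually_gt_atTop 0] with H hH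
    all_goals have hp : (0 : ℝ) < 2 * H := by positivity
    · rw [le_div_iff₀ hp, sub_mul, div_mul_cancel₀ _ hp.ne']
      have := (key H hH).1; rw [e] at this; linarith
    · exact div_le_one_of_le₀ (key H hH).2 hp.le
  · refine tendsto_of_tendsto_of_tendsto_of_le_of_le' tendsto_const_nhds h2 ?_ ?_ <;>
      filter_upwards [eventually_gt_atTop 0] with H hH
    all_goals have hp : (0 : ℝ) < 2 * H := by positivity
    · rw [le_div_iff₀ hp, one_mul]; exact (key H hH).1.le
    · rw [div_le_iff₀ hp, e, add_mul, div_mul_cancel₀ _ hp.ne']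
      have := (key H hH).2; linarith

open Filter Topology Classical in
/-- Every residue class modulo a nonzero ideal `M` has density `1 / N(M)` in the boxes. -/
theorem tendsto_card_boxFinset_filter_mk {M : Ideal (𝓞 K)} (hM : M ≠ ⊥) (r : 𝓞 K ⧸ M) :
    Tendsto (fun H : ℕ => (#{x ∈ boxFinset E H | Ideal.Quotient.mk M x = r} : ℝ) /
      (2 * H) ^ Module.finrank ℚ K) atTop (𝓝 (Ideal.absNorm M : ℝ)⁻¹) := by
  have hN : 0 < Ideal.absNorm M := Nat.pos_of_ne_zero fun h => hM (Ideal.absNorm_eq_zero_iff.1 h)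
  have hNR : (0 : ℝ) < Ideal.absNorm M := by exact_mod_cast hN
  obtain ⟨t1, t2⟩ := tendsto_div_mul_div _ hN
  have key := fun H => card_boxFinset_filter_mk (E := E) hN (Ideal.absNorm_mem M) H r
  have s1 := (t1.pow (Module.finrank ℚ K)).mul_const (Ideal.absNorm M : ℝ)⁻¹
  have s2 := (t2.pow (Module.finrank ℚ K)).mul_const (Ideal.absNorm M : ℝ)⁻¹
  rw [one_pow, one_mul] at s1 s2
  refine tendsto_of_tendsto_of_tendsto_of_le_of_le s1 s2 (fun H => ?_) (fun H => ?_)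
  · dsimp only
    rw [div_pow, div_mul_eq_mul_div]
    gcongr
    rw [← div_eq_mul_inv, div_le_iff₀' hNR]
    exact_mod_cast (key H).1
  · dsimp only
    rw [div_pow, div_mul_eq_mul_div]
    gcongr
    rw [← div_eq_mul_inv, le_div_iff₀' hNR]
    exact_mod_cast (key H).2

end Box

/-! ### Densities of congruence conditions at finitely many primes. -/

section Density

open Finset IsDedekindDomain

variable {K : Type*} [Field K] [NumberField K]
  (E : Module.Basis (Fin (Module.finrank ℚ K)) ℤ (𝓞 K))

/-- The box `O(H, E) ^ n` as a finite set. -/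
noncomputable def tupleBox (n H : ℕ) : Finset (Fin n → 𝓞 K) :=
  Fintype.piFinset fun _ => boxFinset E H

variable {E}

theorem card_tupleBox (n H : ℕ) : #(tupleBox E n H) = (2 * H) ^ (n * Module.finrank ℚ K) := by
  rw [tupleBox, Fintype.card_piFinset, prod_const, card_boxFinset, card_univ, Fintype.card_fin,
    ← pow_mul, mul_comm n]

open Classical in
theorem ncard_inter_box {n : ℕ} (T : Set (Fin n → 𝓞 K)) (H : ℕ) :
    (T ∩ {a | ∀ i, a i ∈ box E H}).ncard = #{a ∈ tupleBox E n H | a ∈ T} := by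
  rw [← Set.ncard_coe_finset]
  congr 1
  ext a
  simp only [← coe_boxFinset, tupleBox, Set.mem_inter_iff, Set.mem_ofPred_eq, mem_coe, mem_filter,
    Fintype.mem_piFinset]
  exact and_comm

open Filter Topology Classical in
/-- A set of tuples defined by congruence conditions modulo a nonzero ideal has the expected
density. -/
theorem hasDensityWrt_preimage_mk {n : ℕ} {M : Ideal (𝓞 K)} (hM : M ≠ ⊥)
    (T : Set (Fin n → 𝓞 K ⧸ M)) :
    HasDensityWrt E {a : Fin n → 𝓞 K | Ideal.Quotient.mk M ∘ a ∈ T}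
      (T.ncard / (Ideal.absNorm M : ℝ) ^ n) := by
  have : Finite (𝓞 K ⧸ M) :=
    (Ideal.absNorm_ne_zero_iff M).1 fun h => hM (Ideal.absNorm_eq_zero_iff.1 h)
  have hT : T.Finite := Set.toFinite T
  have hcount (H : ℕ) : #{a ∈ tupleBox E n H | Ideal.Quotient.mk M ∘ a ∈ T} =
      ∑ r ∈ hT.toFinset, ∏ i, #{x ∈ boxFinset E H | Ideal.Quotient.mk M x = r i} := by
    rw [card_eq_sum_card_fiberwise (f := fun a => Ideal.Quotient.mk M ∘ a) (t := hT.toFinset)]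
    · refine sum_congr rfl fun r hr => ?_
      rw [← Fintype.card_piFinset]
      congr 1
      ext a
      simp only [mem_filter, tupleBox, Fintype.mem_piFinset, funext_iff, forall_and,
        Function.comp_apply]
      refine ⟨fun h => ⟨h.1.1, h.2⟩, fun h => ⟨⟨h.1, ?_⟩, h.2⟩⟩
      rw [show Ideal.Quotient.mk M ∘ a = r from funext h.2]
      exact hT.mem_toFinset.1 hr
    · intro a ha
      simp only [coe_filter, Set.mem_ofPred_eq] at ha
      exact hT.mem_toFinset.2 ha.2
  have hlim : Tendsto (fun H : ℕ => ∑ r ∈ hT.toFinset, ∏ i : Fin n,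
      ((#{x ∈ boxFinset E H | Ideal.Quotient.mk M x = r i} : ℝ) /
        (2 * H) ^ Module.finrank ℚ K)) atTop
      (𝓝 (∑ r ∈ hT.toFinset, ∏ _i : Fin n, (Ideal.absNorm M : ℝ)⁻¹)) :=
    tendsto_finsetSum _ fun r _ => tendsto_finsetProd _ fun i _ =>
      tendsto_card_boxFinset_filter_mk hM (r i)
  rw [HasDensityWrt]
  convert! hlim using 2 with H
  · rw [ncard_inter_box, show #{a ∈ tupleBox E n H | a ∈
      {a : Fin n → 𝓞 K | Ideal.Quotient.mk M ∘ a ∈ T}} = _ from hcount H]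
    push_cast
    rw [sum_div]
    refine sum_congr rfl fun r _ => ?_
    rw [prod_div_distrib, prod_const, card_univ, Fintype.card_fin, ← pow_mul, mul_comm n]
  · rw [sum_const, prod_const, card_univ, Fintype.card_fin, nsmul_eq_mul, inv_pow,
      div_eq_mul_inv, Set.ncard_eq_toFinset_card T hT]

theorem card_quotient_sq (P : HeightOneSpectrum (𝓞 K)) :
    Nat.card (𝓞 K ⧸ P.asIdeal ^ 2) = Ideal.absNorm P.asIdeal ^ 2 := by
  rw [← map_pow, Ideal.absNorm_apply, Submodule.cardQuot_apply]

theorem one_lt_absNorm (P : HeightOneSpectrum (𝓞 K)) : 1 < Ideal.absNorm P.asIdeal := by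
  have h0 : Ideal.absNorm P.asIdeal ≠ 0 := fun h => P.ne_bot (Ideal.absNorm_eq_zero_iff.1 h)
  have h1 : Ideal.absNorm P.asIdeal ≠ 1 := fun h =>
    P.isPrime.ne_top (Ideal.absNorm_eq_one_iff.1 h)
  omega

theorem ncard_compl_localSet_div {d : ℕ} (hd : 2 ≤ d) (P : HeightOneSpectrum (𝓞 K)) :
    ((localSet d (P.asIdeal.map (Ideal.Quotient.mk (P.asIdeal ^ 2))))ᶜ.ncard : ℝ) /
      (Nat.card (𝓞 K ⧸ P.asIdeal ^ 2) : ℝ) ^ (d + 1) =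
    1 - ((Ideal.absNorm P.asIdeal : ℝ) - 1) ^ 2 / (Ideal.absNorm P.asIdeal : ℝ) ^ (d + 1) := by
  set S := 𝓞 K ⧸ P.asIdeal ^ 2
  set N := Ideal.absNorm P.asIdeal with hN
  set m := P.asIdeal.map (Ideal.Quotient.mk (P.asIdeal ^ 2))
  have h1 : 1 < N := one_lt_absNorm P
  have hS : Nat.card S = N ^ 2 := card_quotient_sq P
  have : Finite S := Nat.finite_of_card_ne_zero (by rw [hS]; positivity)
  have hle : P.asIdeal ^ 2 ≤ P.asIdeal := Ideal.pow_le_self two_ne_zero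
  have hm2 : m ^ 2 = ⊥ := by rw [← Ideal.map_pow, Ideal.map_quotient_self]
  have hmp : m.IsPrime := by
    have := P.isPrime
    exact Ideal.map_isPrime_of_surjective Ideal.Quotient.mk_surjective (by rwa [Ideal.mk_ker])
  have hq : Nat.card (S ⧸ m) = N :=
    (Nat.card_congr (DoubleQuot.quotQuotEquivQuotOfLE hle).toEquiv).trans
      (by rw [hN, Ideal.absNorm_apply, Submodule.cardQuot_apply])
  have hm : Nat.card m = N := by
    have := Submodule.card_eq_card_quotient_mul_card m
    rw [hS, hq, sq] at this
    exact (Nat.eq_of_mul_eq_mul_right (show 0 < N by omega) this).symm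
  have hl := ncard_localSet (S := S) (P := m) hm2 hd
  rw [hq, hS, hm] at hl
  have htot := Set.ncard_add_ncard_compl (localSet d m)
  rw [hl, Nat.card_fun, Nat.card_eq_fintype_card (α := Fin (d + 1)), Fintype.card_fin, hS] at htot
  have hNR : (0 : ℝ) < N := by exact_mod_cast (by omega : 0 < N)
  have htot' : ((localSet d m)ᶜ.ncard : ℝ) = ((N : ℝ) ^ 2) ^ (d + 1) -
      N * ((N ^ 2 - N) * N ^ (d - 1) * (N - 1)) := by
    rw [eq_sub_iff_add_eq']
    have := congrArg (Nat.cast (R := ℝ)) htot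
    push_cast [Nat.cast_sub (show N ≤ N ^ 2 by nlinarith), Nat.cast_sub h1.le] at this
    exact this
  rw [htot', hS]
  obtain ⟨e, rfl⟩ : ∃ e, d = e + 1 := ⟨d - 1, by omega⟩
  rw [Nat.add_sub_cancel]
  push_cast
  field_simp
  ring

theorem quotientInfRingEquivPiQuotient_mk {R ι : Type*} [CommRing R] [Finite ι] (I : ι → Ideal R)
    (hI : Pairwise (Function.onFun IsCoprime I)) (x : R) (i : ι) :
    Ideal.quotientInfRingEquivPiQuotient I hI (Ideal.Quotient.mk _ x) i =
      Ideal.Quotient.mk (I i) x := rfl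

/-- The tuples which are not shifted `P`-Eisenstein for any `P` in a finite set `S` of primes. -/
theorem hasDensityWrt_forall_notMem_localSet {d : ℕ} (hd : 2 ≤ d)
    (S : Finset (HeightOneSpectrum (𝓞 K))) :
    HasDensityWrt E {a : Fin (d + 1) → 𝓞 K | ∀ P ∈ S, a ∉ localSet d P.asIdeal}
      (∏ P ∈ S, (1 - ((Ideal.absNorm P.asIdeal : ℝ) - 1) ^ 2 /
        (Ideal.absNorm P.asIdeal : ℝ) ^ (d + 1))) := by
  set I : S → Ideal (𝓞 K) := fun P => P.1.asIdeal ^ 2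
  have hI : Pairwise (Function.onFun IsCoprime I) := fun P Q h =>
    HeightOneSpectrum.isCoprime_pow_of_ne _ _ (fun h' => h (Subtype.ext h')) _ _
  -- The modulus is the intersection of the coprime ideals `P ^ 2`; by the Chinese remainder theorem
  -- the conditions at different primes become independent.
  set M := ⨅ P, I P
  obtain ⟨e, he⟩ : ∃ e : 𝓞 K ⧸ M ≃+* ∀ P, 𝓞 K ⧸ I P,
      ∀ x P, e (Ideal.Quotient.mk M x) P = Ideal.Quotient.mk (I P) x :=
    ⟨_, quotientInfRingEquivPiQuotient_mk I hI⟩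
  have hcardM : Nat.card (𝓞 K ⧸ M) = ∏ P, Nat.card (𝓞 K ⧸ I P) :=
    (Nat.card_congr e.toEquiv).trans Nat.card_pi
  have hM : M ≠ ⊥ := by
    intro h
    have h0 : Ideal.absNorm M = 0 := Ideal.absNorm_eq_zero_iff.2 h
    rw [Ideal.absNorm_apply, Submodule.cardQuot_apply, hcardM, prod_eq_zero_iff] at h0
    obtain ⟨P, -, hP⟩ := h0
    rw [card_quotient_sq] at hP
    have := one_lt_absNorm P.1
    exact absurd hP (by positivity)
  let L (P : S) : Set (Fin (d + 1) → 𝓞 K ⧸ I P) :=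
    (localSet d (P.1.asIdeal.map (Ideal.Quotient.mk (P.1.asIdeal ^ 2))))ᶜ
  let T : Set (Fin (d + 1) → 𝓞 K ⧸ M) := {r | ∀ P, (fun i => e (r i) P) ∈ L P}
  have hT : T.ncard = ∏ P, (L P).ncard := by
    rw [← Nat.card_coe_set_eq]
    simp_rw [← Nat.card_coe_set_eq]
    rw [← Nat.card_pi]
    refine Nat.card_congr ?_
    exact (Equiv.subtypeEquiv
      (((Equiv.refl (Fin (d + 1))).arrowCongr e.toEquiv).trans (Equiv.piComm _))
      (fun r => Iff.rfl)).trans (Equiv.subtypePiEquivPi (p := fun P a => a ∈ L P))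
  have hset : {a : Fin (d + 1) → 𝓞 K | ∀ P ∈ S, a ∉ localSet d P.asIdeal} =
      {a | Ideal.Quotient.mk M ∘ a ∈ T} := by
    ext a
    have h (P : S) : (fun i => e ((Ideal.Quotient.mk M ∘ a) i) P) ∈ L P ↔
        a ∉ localSet d P.1.asIdeal := by
      rw [← comp_mem_localSet_iff (φ := Ideal.Quotient.mk (P.1.asIdeal ^ 2))
        Ideal.Quotient.mk_surjective (by rw [Ideal.mk_ker])]
      simp only [Function.comp_apply, he]
      exact Iff.rfl
    exact ⟨fun ha P => (h P).2 (ha P.1 P.2), fun ha P hP => (h ⟨P, hP⟩).1 (ha ⟨P, hP⟩)⟩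
  have key := hasDensityWrt_preimage_mk (E := E) hM T
  rw [hset]
  convert key using 1
  rw [hT, Ideal.absNorm_apply, Submodule.cardQuot_apply, hcardM]
  push_cast
  rw [← prod_pow, ← prod_div_distrib, ← prod_coe_sort S]
  exact prod_congr rfl fun P _ => (ncard_compl_localSet_div hd P.1).symm

end Density

/-! ### Tail estimate: small primes, large primes and norms. -/

section Tail

open Finset IsDedekindDomain

/-- With `d = e + 3`, the top coefficients modulo `P` are `u`, `d * u * c` and `choose d 2 * u * c ^
2`; this is the relation left after eliminating `u` and `c`. The lowest index is `e + 1 ≥ 1`, so `a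
0` stays free. -/
theorem sub_mem_of_mem_localSet {R : Type*} [CommRing R] {e : ℕ} {P : Ideal R}
    {a : Fin (e + 3 + 1) → R} (ha : a ∈ localSet (e + 3) P) :
    ((e + 2 : ℕ) : R) * a ⟨e + 2, by omega⟩ ^ 2 -
      ((2 * (e + 3) : ℕ) : R) * (a (Fin.last _) * a ⟨e + 1, by omega⟩) ∈ P := by
  obtain ⟨u, c, -, h⟩ := exists_of_mem_localSet ha
  have h1 := h (Fin.last _)
  have h2 := h ⟨e + 2, by omega⟩
  have h3 := h ⟨e + 1, by omega⟩
  rw [← Ideal.Quotient.eq] at h1 h2 h3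
  rw [← Ideal.Quotient.eq]
  have hc2 : (e + 3).choose (e + 2) = e + 3 := Nat.choose_succ_self_right _
  have hc3 : 2 * (e + 3).choose (e + 1) = (e + 3) * (e + 2) := by
    rw [Nat.choose_symm_of_eq_add (show e + 3 = (e + 1) + 2 by omega), mul_comm,
      Nat.choose_two_right, Nat.div_mul_cancel (Nat.even_mul_pred_self _).two_dvd]
    rfl
  have hc3' : (2 : R ⧸ P) * ((e + 3).choose (e + 1) : ℕ) = ((e : R ⧸ P) + 3) * (e + 2) := by
    exact_mod_cast congrArg (Nat.cast (R := R ⧸ P)) hc3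
  simp only [map_mul, map_pow, map_natCast, Fin.val_last, Nat.choose_self, Nat.sub_self, pow_zero,
    mul_one, Nat.cast_one, hc2, show e + 3 - (e + 2) = 1 by omega, pow_one,
    show e + 3 - (e + 1) = 2 by omega] at h1 h2 h3 ⊢
  rw [h1, h2, h3]
  push_cast
  linear_combination (-(e : R ⧸ P) - 3) * (Ideal.Quotient.mk P u) ^ 2 *
    (Ideal.Quotient.mk P c) ^ 2 * hc3'

/-- When the degree is nonzero modulo `P`, the top two coefficients `u` and `d * u * c` determine
`c`, hence also `a 0 ≡ u * c ^ d`. -/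
theorem mk_apply_zero_eq_of_mem_localSet {R : Type*} [CommRing R] {e : ℕ} {P : Ideal R} [P.IsPrime]
    (hd : ((e + 2 : ℕ) : R) ∉ P) {a b : Fin (e + 2 + 1) → R} (ha : a ∈ localSet (e + 2) P)
    (hb : b ∈ localSet (e + 2) P) (hab : ∀ i : Fin (e + 2), a i.succ = b i.succ) :
    Ideal.Quotient.mk P (a 0) = Ideal.Quotient.mk P (b 0) := by
  obtain ⟨u, c, hu, h⟩ := exists_of_mem_localSet ha
  obtain ⟨v, w, hv, k⟩ := exists_of_mem_localSet hb
  simp only [← Ideal.Quotient.eq, map_mul, map_pow, map_natCast] at h k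
  have h1 := (h (Fin.last _)).symm.trans ((congrArg _ (hab (Fin.last _))).trans (k (Fin.last _)))
  have h2 := (h (Fin.succ ⟨e, by omega⟩)).symm.trans
    ((congrArg _ (hab ⟨e, by omega⟩)).trans (k (Fin.succ ⟨e, by omega⟩)))
  simp only [Fin.val_last, Nat.choose_self, Nat.sub_self, pow_zero, mul_one, Nat.cast_one,
    Fin.val_succ, show e + 2 - (e + 1) = 1 by omega, pow_one] at h1 h2
  rw [show (e + 2).choose (e + 1) = e + 2 from Nat.choose_succ_self_right _, ← h1] at h2
  have hu' : Ideal.Quotient.mk P u ≠ 0 := by rwa [Ne, Ideal.Quotient.eq_zero_iff_mem]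
  have hd' : ((e + 2 : ℕ) : R ⧸ P) ≠ 0 := by
    rwa [← map_natCast (Ideal.Quotient.mk P), Ne, Ideal.Quotient.eq_zero_iff_mem]
  have hc := mul_left_cancel₀ hd' (mul_left_cancel₀ hu' h2)
  rw [h 0, k 0, ← h1, hc]

variable {K : Type*} [Field K] [NumberField K]
  {E : Module.Basis (Fin (Module.finrank ℚ K)) ℤ (𝓞 K)}

open Classical in
-- There are `N ^ 2` pairs `(u, c)` modulo `P`, each fixing one residue class per coordinate. Since
-- `q ≤ 2 * H`, the rounding in the class count at most doubles the side, whence `4 * H`.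
theorem card_tupleBox_filter_localSet_le {d q H : ℕ} (P : HeightOneSpectrum (𝓞 K)) (hq : 0 < q)
    (hqH : q ≤ 2 * H) (hP : (q : 𝓞 K) ∈ P.asIdeal) :
    Ideal.absNorm P.asIdeal ^ (d + 1) * #{a ∈ tupleBox E (d + 1) H | a ∈ localSet d P.asIdeal} ≤
      Ideal.absNorm P.asIdeal ^ 2 * (4 * H) ^ ((d + 1) * Module.finrank ℚ K) := by
  set N := Ideal.absNorm P.asIdeal with hN
  have hN1 : 1 < N := one_lt_absNorm P
  set Q := 𝓞 K ⧸ P.asIdeal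
  have hQ : Nat.card Q = N := by rw [hN, Ideal.absNorm_apply, Submodule.cardQuot_apply]
  have : Finite Q := Nat.finite_of_card_ne_zero (by omega)
  have : Fintype Q := Fintype.ofFinite Q
  let B (p : Q × Q) : Finset (Fin (d + 1) → 𝓞 K) := Fintype.piFinset fun i : Fin (d + 1) =>
    {x ∈ boxFinset E H | Ideal.Quotient.mk P.asIdeal x = p.1 * (d.choose i * p.2 ^ (d - i : ℕ))}
  have hB (p : Q × Q) : N ^ (d + 1) * #(B p) ≤ (4 * H) ^ ((d + 1) * Module.finrank ℚ K) := by
    rw [Fintype.card_piFinset]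
    calc _ = ∏ i : Fin (d + 1), N * #{x ∈ boxFinset E H |
          Ideal.Quotient.mk P.asIdeal x = p.1 * (d.choose i * p.2 ^ (d - i : ℕ))} := by
          rw [prod_mul_distrib, prod_const, card_univ, Fintype.card_fin]
      _ ≤ ∏ _i : Fin (d + 1), (4 * H) ^ Module.finrank ℚ K := by
          refine prod_le_prod' fun i _ => (card_boxFinset_filter_mk hq hP H _).2.trans ?_
          refine Nat.pow_le_pow_left ?_ _
          rw [add_mul, one_mul]
          have := Nat.div_mul_le_self (2 * H) q
          omega
      _ = _ := by rw [prod_const, card_univ, Fintype.card_fin, ← pow_mul, mul_comm (d + 1)]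
  have hsub : {a ∈ tupleBox E (d + 1) H | a ∈ localSet d P.asIdeal} ⊆ univ.biUnion B := by
    intro a ha
    rw [mem_filter, tupleBox, Fintype.mem_piFinset] at ha
    obtain ⟨u, c, -, h⟩ := exists_of_mem_localSet ha.2
    simp only [mem_biUnion, mem_univ, true_and, B, Fintype.mem_piFinset, mem_filter]
    refine ⟨(Ideal.Quotient.mk _ u, Ideal.Quotient.mk _ c), fun i => ⟨ha.1 i, ?_⟩⟩
    simpa using Ideal.Quotient.eq.2 (h i)
  calc _ ≤ N ^ (d + 1) * ∑ p, #(B p) :=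
        Nat.mul_le_mul_left _ ((card_le_card hsub).trans card_biUnion_le)
    _ = ∑ p, N ^ (d + 1) * #(B p) := mul_sum _ _ _
    _ ≤ ∑ _p : Q × Q, (4 * H) ^ ((d + 1) * Module.finrank ℚ K) := sum_le_sum fun p _ => hB p
    _ = _ := by
        rw [sum_const, card_univ, Fintype.card_prod, ← Nat.card_eq_fintype_card, hQ, smul_eq_mul, sq]

/-- `P` contains no positive integer up to `2 * H`. -/
def IsLarge (H : ℕ) (P : HeightOneSpectrum (𝓞 K)) : Prop :=
  ∀ q : ℕ, 0 < q → q ≤ 2 * H → (q : 𝓞 K) ∉ P.asIdeal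

theorem IsLarge.lt_absNorm {H : ℕ} {P : HeightOneSpectrum (𝓞 K)} (hP : IsLarge H P) :
    2 * H < Ideal.absNorm P.asIdeal := by
  by_contra! h
  exact hP _ (by have := one_lt_absNorm P; omega) h (Ideal.absNorm_mem _)

omit [NumberField K] in
theorem IsLarge.eq_zero {H : ℕ} {P : HeightOneSpectrum (𝓞 K)} (hP : IsLarge H P) {n : ℤ}
    (hn : |n| ≤ 2 * H) (h : (n : 𝓞 K) ∈ P.asIdeal) : n = 0 := by
  by_contra h0
  rw [Int.abs_eq_natAbs] at hn
  refine hP n.natAbs (Int.natAbs_pos.2 h0) (by omega) ?_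
  rcases Int.natAbs_eq n with h' | h'
  · rwa [h', Int.cast_natCast] at h
  · rwa [h', Int.cast_neg, neg_mem_iff, Int.cast_natCast] at h

open Classical in
-- Some basis element `E j` is not in `P`. Two members of a class that differ only in coordinate `j`
-- differ by `n • E j` with `|n| < 2 * H`, so `n ∈ P` and `n = 0` by largeness. Each class thus
-- saves a full factor `2 * H`.
theorem IsLarge.card_boxFinset_filter_mk_le {H : ℕ} {P : HeightOneSpectrum (𝓞 K)}
    (hP : IsLarge H P) (r : 𝓞 K ⧸ P.asIdeal) :
    2 * H * #{x ∈ boxFinset E H | Ideal.Quotient.mk P.asIdeal x = r} ≤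
      (2 * H) ^ Module.finrank ℚ K := by
  obtain ⟨j, hj⟩ : ∃ j, E j ∉ P.asIdeal := by
    by_contra! h
    refine P.isPrime.ne_top ((Ideal.eq_top_iff_one _).2 ?_)
    rw [← E.sum_repr 1]
    exact Ideal.sum_mem _ fun i _ => zsmul_mem (h i) _
  have hI : #(Ico (-(H : ℤ)) H) = 2 * H := by rw [Int.card_Ico]; omega
  rw [← card_boxFinset (E := E), ← hI, ← card_product]
  have hr (c : ℤ) (x : 𝓞 K) (i) : E.repr (x + (c - E.repr x j) • E j) i =
      if i = j then c else E.repr x i := by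
    rw [map_add, map_zsmul, Module.Basis.repr_self]
    simp only [Finsupp.add_apply, Finsupp.smul_apply, Finsupp.single_apply, smul_eq_mul]
    split_ifs with h1 h2 h2
    · subst h1; ring
    · exact absurd h1.symm h2
    · exact absurd h2.symm h1
    · ring
  -- The map overwrites coordinate `j` by `p.1`, so it stays in the box.
  refine card_le_card_of_injOn (fun p => p.2 + (p.1 - E.repr p.2 j) • E j) ?_ ?_
  · rintro ⟨c, x⟩ hx
    simp only [coe_product, Set.mem_prod, mem_coe, mem_filter, mem_boxFinset, mem_Ico] at hx ⊢
    intro i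
    rw [hr]
    split_ifs
    · exact hx.1
    · exact hx.2.1 i
  · rintro ⟨c, x⟩ hx ⟨c', x'⟩ hx' heq
    simp only [coe_product, Set.mem_prod, mem_coe, mem_filter, mem_boxFinset, mem_Ico] at hx hx' heq
    have hrep (i) : (if i = j then c else E.repr x i) = if i = j then c' else E.repr x' i := by
      rw [← hr, ← hr, heq]
    have hcc : c = c' := by simpa using hrep j
    have hsub : x - x' = (E.repr x j - E.repr x' j) • E j := by
      subst hcc
      rw [sub_smul, sub_smul] at heq
      rw [sub_smul]
      linear_combination heq
    have hmem : x - x' ∈ P.asIdeal := by rw [← Ideal.Quotient.eq, hx.2.2, hx'.2.2]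
    rw [hsub, zsmul_eq_mul] at hmem
    have h0 := hP.eq_zero (n := E.repr x j - E.repr x' j) (by
      have a1 := hx.2.1 j; have a2 := hx'.2.1 j
      simp only [Set.mem_Ico] at a1 a2
      rw [abs_le]; omega) ((P.isPrime.mem_or_mem hmem).resolve_right hj)
    rw [h0, zero_smul, sub_eq_zero] at hsub
    rw [hsub, hcc]

/-- Distinct primes are coprime, so their product divides `x`, and each contributes a norm above `2
* H`. -/
theorem pow_card_le_natAbs_norm {H : ℕ} {x : 𝓞 K} (hx : x ≠ 0)
    (S : Finset (HeightOneSpectrum (𝓞 K))) (hS : ∀ P ∈ S, IsLarge H P ∧ x ∈ P.asIdeal) :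
    (2 * H) ^ #S ≤ (Algebra.norm ℤ x).natAbs := by
  have hinj : Set.InjOn (fun P : HeightOneSpectrum (𝓞 K) => P.asIdeal) S :=
    fun P _ Q _ h => HeightOneSpectrum.ext h
  have hdvd : ∏ P ∈ S, P.asIdeal ∣ Ideal.span {x} := by
    refine Finset.prod_dvd_of_coprime (fun P _ Q _ hPQ => ?_) fun P hP => ?_
    · have := HeightOneSpectrum.isCoprime_pow_of_ne P Q hPQ 1 1
      simpa using this
    · rw [Ideal.dvd_iff_le, Ideal.span_singleton_le_iff_mem]
      exact (hS P hP).2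
  have h := map_dvd Ideal.absNorm hdvd
  rw [Ideal.absNorm_span_singleton, map_prod] at h
  have h0 : (Algebra.norm ℤ x).natAbs ≠ 0 := by
    rw [Int.natAbs_ne_zero]; exact Algebra.norm_ne_zero_iff.2 hx
  refine le_trans ?_ (Nat.le_of_dvd (Nat.pos_of_ne_zero h0) h)
  rw [← prod_const]
  exact prod_le_prod' fun P hP => (hS P hP).1.lt_absNorm.le

theorem natAbs_norm_le_of_forall_embedding {x : 𝓞 K} {A : ℝ} (h : ∀ σ : K →+* ℂ, ‖σ x‖ ≤ A) :
    ((Algebra.norm ℤ x).natAbs : ℝ) ≤ A ^ Module.finrank ℚ K := by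
  have h1 : ((Algebra.norm ℤ x).natAbs : ℝ) = ‖((Algebra.norm ℚ (x : K) : ℚ) : ℂ)‖ := by
    rw [← Algebra.coe_norm_int, Nat.cast_natAbs]
    simp
  have h2 := Algebra.norm_eq_prod_embeddings ℚ ℂ (x : K)
  rw [h1, show ((Algebra.norm ℚ (x : K) : ℚ) : ℂ) =
    algebraMap ℚ ℂ (Algebra.norm ℚ (x : K)) from rfl,
    h2, norm_prod]
  calc _ ≤ ∏ _σ : K →ₐ[ℚ] ℂ, A := prod_le_prod (fun _ _ => norm_nonneg _) fun σ _ => h σ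
    _ = _ := by rw [prod_const, card_univ, AlgHom.card]

theorem exists_forall_norm_embedding_le (E : Module.Basis (Fin (Module.finrank ℚ K)) ℤ (𝓞 K)) :
    ∃ A : ℝ, 0 ≤ A ∧ ∀ H : ℕ, ∀ x ∈ boxFinset E H, ∀ σ : K →+* ℂ, ‖σ x‖ ≤ A * H := by
  refine ⟨∑ σ : K →+* ℂ, ∑ j, ‖σ (E j)‖, by positivity, fun H x hx σ => ?_⟩
  rw [mem_boxFinset] at hx
  calc ‖σ x‖ = ‖∑ j, (E.repr x j : ℂ) * σ (E j)‖ := by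
        conv_lhs => rw [← E.sum_repr x]
        simp
    _ ≤ ∑ j, ‖σ (E j)‖ * H := by
        refine (norm_sum_le _ _).trans (sum_le_sum fun j _ => ?_)
        rw [norm_mul, mul_comm, Complex.norm_intCast]
        gcongr
        have := hx j
        rw [Set.mem_Ico] at this
        have h2 : |E.repr x j| ≤ (H : ℤ) := abs_le.2 ⟨this.1, this.2.le⟩
        exact_mod_cast h2
    _ = (∑ j, ‖σ (E j)‖) * H := (sum_mul _ _ _).symm
    _ ≤ _ := by
        gcongr
        exact single_le_sum (f := fun σ : K →+* ℂ => ∑ j, ‖σ (E j)‖)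
          (fun _ _ => by positivity) (mem_univ σ)

/-- The expression is quadratic in the box elements, so its norm is at most `C * H ^ (2 * k)`; once
`C ≤ H`, the constant costs only one more factor, which explains `2 * k + 1`. -/
theorem exists_forall_card_le (E : Module.Basis (Fin (Module.finrank ℚ K)) ℤ (𝓞 K)) (m n : ℕ) :
    ∃ H₀ : ℕ, ∀ H ≥ H₀, ∀ x ∈ boxFinset E H, ∀ y ∈ boxFinset E H, ∀ z ∈ boxFinset E H,
      (m : 𝓞 K) * x ^ 2 - (n : 𝓞 K) * (y * z) ≠ 0 →
      ∀ S : Finset (HeightOneSpectrum (𝓞 K)),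
        (∀ P ∈ S, IsLarge H P ∧ (m : 𝓞 K) * x ^ 2 - (n : 𝓞 K) * (y * z) ∈ P.asIdeal) →
        #S ≤ 2 * Module.finrank ℚ K + 1 := by
  obtain ⟨A, hA0, hA⟩ := exists_forall_norm_embedding_le E
  set k := Module.finrank ℚ K
  set C : ℝ := ((m + n) * A ^ 2) ^ k
  refine ⟨⌈C⌉₊ + 1, fun H hH x hx y hy z hz h0 S hS => ?_⟩
  have hCH : C ≤ H := (Nat.le_ceil C).trans (by exact_mod_cast (by omega : ⌈C⌉₊ ≤ H))
  have h1 := pow_card_le_natAbs_norm h0 S hS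
  have h2 := natAbs_norm_le_of_forall_embedding
    (x := (m : 𝓞 K) * x ^ 2 - (n : 𝓞 K) * (y * z)) (A := (m + n) * A ^ 2 * H ^ 2) fun σ => by
      have e : σ (((m : 𝓞 K) * x ^ 2 - (n : 𝓞 K) * (y * z) : 𝓞 K) : K) =
        (m : ℂ) * σ x ^ 2 - (n : ℂ) * (σ y * σ z) := by simp
      rw [e]
      calc _ ≤ (m : ℝ) * ‖σ x‖ ^ 2 + n * (‖σ y‖ * ‖σ z‖) := by
            refine (norm_sub_le _ _).trans (le_of_eq ?_)
            simp
        _ ≤ (m : ℝ) * (A * H) ^ 2 + n * ((A * H) * (A * H)) := by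
            gcongr
            · exact hA H x hx σ
            · exact hA H y hy σ
            · exact hA H z hz σ
        _ = _ := by ring
  have h3 : ((2 * H : ℕ) : ℝ) ^ #S ≤ ((2 * H : ℕ) : ℝ) ^ (2 * k + 1) := by
    calc ((2 * H : ℕ) : ℝ) ^ #S ≤ _ := by exact_mod_cast h1
      _ ≤ ((m + n) * A ^ 2 * H ^ 2) ^ k := h2
      _ = C * (H : ℝ) ^ (2 * k) := by rw [mul_pow, ← pow_mul]
      _ ≤ H * (H : ℝ) ^ (2 * k) := by gcongr
      _ = (H : ℝ) ^ (2 * k + 1) := by ring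
      _ ≤ _ := by
        gcongr
        omega
  exact (pow_le_pow_iff_right₀ (by exact_mod_cast (by omega : 1 < 2 * H))).1 h3

end Tail

/-! ### Tail estimate: assembling the two ranges of primes. -/

section Tail

open Finset IsDedekindDomain

variable {K : Type*} [Field K] [NumberField K]
  {E : Module.Basis (Fin (Module.finrank ℚ K)) ℤ (𝓞 K)}

theorem mem_tupleBox {n H : ℕ} {a : Fin n → 𝓞 K} :
    a ∈ tupleBox E n H ↔ ∀ i, a i ∈ boxFinset E H := Fintype.mem_piFinset

/-- A set of tuples in which one coordinate is determined by the others is small. -/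
theorem pow_mul_card_le_of_injOn_update {n H : ℕ} (j : Fin n) (B : Finset (Fin n → 𝓞 K))
    (hB : B ⊆ tupleBox E n H)
    (hinj : ∀ a ∈ B, ∀ b ∈ B, (∀ i, i ≠ j → a i = b i) → a j = b j) :
    (2 * H) ^ Module.finrank ℚ K * #B ≤ (2 * H) ^ (n * Module.finrank ℚ K) := by
  rw [← card_boxFinset (E := E), ← card_tupleBox (E := E), ← card_product]
  refine card_le_card_of_injOn (fun p => Function.update p.2 j p.1) ?_ ?_
  · rintro ⟨y, a⟩ h
    simp only [coe_product, Set.mem_prod, mem_coe] at h ⊢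
    rw [mem_tupleBox]
    intro i
    rw [Function.update_apply]
    split_ifs
    · exact h.1
    · exact mem_tupleBox.1 (hB h.2) i
  · rintro ⟨y, a⟩ h ⟨z, b⟩ h' heq
    simp only [coe_product, Set.mem_prod, mem_coe] at h h' heq
    have hi (i) := congrFun heq i
    simp only [Function.update_apply] at hi
    have hyz : y = z := by simpa using hi j
    have hab (i) (hij : i ≠ j) : a i = b i := by simpa [hij] using hi i
    refine Prod.ext hyz (funext fun i => ?_)
    by_cases hij : i = j
    · rw [hij]; exact hinj a h.2 b h'.2 hab
    · exact hab i hij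

open Classical in
-- With all coefficients except `a 0` fixed, each large prime confines `a 0` to one residue class,
-- and at most `m` primes can occur. The bound `hH` keeps the degree outside every large prime.
theorem mul_card_fiber_le {e m H : ℕ} (hH : e + 2 ≤ 2 * H) (B : Finset (Fin (e + 2 + 1) → 𝓞 K))
    (hB : B ⊆ tupleBox E (e + 2 + 1) H) (t : Fin (e + 2) → 𝓞 K) (hBt : ∀ a ∈ B, Fin.tail a = t)
    (hP : ∀ a ∈ B, ∃ P : HeightOneSpectrum (𝓞 K), IsLarge H P ∧ a ∈ localSet (e + 2) P.asIdeal)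
    (hm : ∀ S : Finset (HeightOneSpectrum (𝓞 K)), (∀ P ∈ S, IsLarge H P ∧
      ∃ a ∈ B, a ∈ localSet (e + 2) P.asIdeal) → #S ≤ m) :
    2 * H * #B ≤ m * (2 * H) ^ Module.finrank ℚ K := by
  rcases B.eq_empty_or_nonempty with rfl | ⟨a₀, ha₀⟩
  · simp
  have : Nonempty (HeightOneSpectrum (𝓞 K)) := ⟨(hP a₀ ha₀).choose⟩
  choose! p hp using hP
  have h1 : 2 * H * #B ≤ ∑ P ∈ B.image p, 2 * H * #{a ∈ B | a ∈ localSet (e + 2) P.asIdeal} := by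
    rw [← mul_sum]
    refine Nat.mul_le_mul_left _ ((card_le_card fun a ha => ?_).trans card_biUnion_le)
    exact mem_biUnion.2 ⟨p a, mem_image_of_mem p ha, mem_filter.2 ⟨ha, (hp a ha).2⟩⟩
  have h2 : ∀ P ∈ B.image p, 2 * H * #{a ∈ B | a ∈ localSet (e + 2) P.asIdeal} ≤
      (2 * H) ^ Module.finrank ℚ K := by
    intro P hP
    obtain ⟨b, hb, rfl⟩ := mem_image.1 hP
    obtain ⟨hl, hbl⟩ := hp b hb
    refine le_trans (Nat.mul_le_mul_left _ ?_)
      (hl.card_boxFinset_filter_mk_le (E := E) (Ideal.Quotient.mk _ (b 0)))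
    refine card_le_card_of_injOn (fun a => a 0) ?_ ?_
    · intro a ha
      rw [mem_coe, mem_filter] at ha ⊢
      refine ⟨mem_tupleBox.1 (hB ha.1) 0, ?_⟩
      have := (p b).isPrime
      refine mk_apply_zero_eq_of_mem_localSet (hl _ (by omega) hH) ha.2 hbl fun i => ?_
      exact congrFun ((hBt a ha.1).trans (hBt b hb).symm) i
    · intro a ha c hc hac
      rw [mem_coe, mem_filter] at ha hc
      rw [← Fin.cons_self_tail a, ← Fin.cons_self_tail c, hBt a ha.1, hBt c hc.1]
      simp only at hac
      rw [hac]
  refine h1.trans ((sum_le_card_nsmul _ _ _ h2).trans ?_)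
  rw [smul_eq_mul]
  refine Nat.mul_le_mul_right _ (hm _ fun P hP => ?_)
  obtain ⟨b, hb, rfl⟩ := mem_image.1 hP
  exact ⟨(hp b hb).1, b, hb, (hp b hb).2⟩

open Classical in
theorem exists_forall_mul_card_isLarge_le
    (E : Module.Basis (Fin (Module.finrank ℚ K)) ℤ (𝓞 K)) (e : ℕ) :
    ∃ H₀ : ℕ, ∀ H ≥ H₀, 2 * H * #{a ∈ tupleBox E (e + 3 + 1) H |
      ∃ P : HeightOneSpectrum (𝓞 K), IsLarge H P ∧ a ∈ localSet (e + 3) P.asIdeal} ≤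
        (2 * Module.finrank ℚ K + 2) * (2 * H) ^ ((e + 3 + 1) * Module.finrank ℚ K) := by
  obtain ⟨H₀, hH₀⟩ := exists_forall_card_le E (e + 2) (2 * (e + 3))
  refine ⟨H₀ + e + 3, fun H hH => ?_⟩
  have hk : 1 ≤ Module.finrank ℚ K := Module.finrank_pos
  set B := {a ∈ tupleBox E (e + 3 + 1) H |
      ∃ P : HeightOneSpectrum (𝓞 K), IsLarge H P ∧ a ∈ localSet (e + 3) P.asIdeal} with hBdef
  let F (t : Fin (e + 3) → 𝓞 K) : 𝓞 K := ((e + 2 : ℕ) : 𝓞 K) * t ⟨e + 1, by omega⟩ ^ 2 -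
    ((2 * (e + 3) : ℕ) : 𝓞 K) * (t (Fin.last _) * t ⟨e, by omega⟩)
  have hF (a : Fin (e + 3 + 1) → 𝓞 K) (P : HeightOneSpectrum (𝓞 K))
      (ha : a ∈ localSet (e + 3) P.asIdeal) : F (Fin.tail a) ∈ P.asIdeal :=
    sub_mem_of_mem_localSet ha
  have hsplit : #B = #{a ∈ B | F (Fin.tail a) = 0} + #{a ∈ B | F (Fin.tail a) ≠ 0} :=
    (card_filter_add_card_filter_not _).symm
  -- The equation `F = 0` is linear in `a_{d-2}`, at index `e + 1`, with coefficient a nonzero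
  -- multiple of the leading coefficient; the latter is nonzero, being outside some `P`.
  have h0 : 2 * H * #{a ∈ B | F (Fin.tail a) = 0} ≤ (2 * H) ^ ((e + 3 + 1) * Module.finrank ℚ K) := by
    refine le_trans (Nat.mul_le_mul_right _ (Nat.le_self_pow
      (show Module.finrank ℚ K ≠ 0 by omega) (2 * H))) ?_
    refine pow_mul_card_le_of_injOn_update (E := E) (⟨e + 1, by omega⟩ : Fin (e + 3 + 1)) _
      ((filter_subset _ _).trans (filter_subset _ _)) fun a ha b hb hab => ?_
    rw [mem_filter, hBdef, mem_filter] at ha hb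
    obtain ⟨P, -, c, hc⟩ := ha.1.2
    have hne : a (Fin.last _) ≠ 0 := fun h => by
      have := hc.1
      rw [translate_last, h] at this
      exact this P.asIdeal.zero_mem
    have e1 := hab ⟨e + 2, by omega⟩ (by simp)
    have e2 := hab (Fin.last _) (by simp [Fin.ext_iff])
    have hFa : ((e + 2 : ℕ) : 𝓞 K) * a ⟨e + 2, by omega⟩ ^ 2 -
      ((2 * (e + 3) : ℕ) : 𝓞 K) * (a (Fin.last _) * a ⟨e + 1, by omega⟩) = 0 := ha.2
    have hFb : ((e + 2 : ℕ) : 𝓞 K) * b ⟨e + 2, by omega⟩ ^ 2 -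
      ((2 * (e + 3) : ℕ) : 𝓞 K) * (b (Fin.last _) * b ⟨e + 1, by omega⟩) = 0 := hb.2
    rw [← e1, ← e2] at hFb
    have h3 : ((2 * (e + 3) : ℕ) : 𝓞 K) ≠ 0 := Nat.cast_ne_zero.2 (by omega)
    refine mul_left_cancel₀ hne (mul_left_cancel₀ h3 ?_)
    linear_combination hFb - hFa
  -- `F` depends on the tail only, so within a fibre of `Fin.tail` the same nonzero element bounds
  -- the number of primes.
  have h1 : 2 * H * #{a ∈ B | F (Fin.tail a) ≠ 0} ≤
      (2 * Module.finrank ℚ K + 1) * (2 * H) ^ ((e + 3 + 1) * Module.finrank ℚ K) := by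
    have hmaps : ∀ a ∈ B, Fin.tail a ∈ tupleBox E (e + 3) H := fun a ha =>
      mem_tupleBox.2 fun i => mem_tupleBox.1 (mem_filter.1 ha).1 i.succ
    rw [card_eq_sum_card_fiberwise (f := Fin.tail) (t := tupleBox E (e + 3) H)
      (fun a ha => hmaps a (mem_filter.1 ha).1), mul_sum]
    calc _ ≤ ∑ _t ∈ tupleBox E (e + 3) H,
          (2 * Module.finrank ℚ K + 1) * (2 * H) ^ Module.finrank ℚ K := ?_
      _ = _ := by
        rw [sum_const, card_tupleBox, smul_eq_mul]; ring
    refine sum_le_sum fun t ht => ?_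
    refine mul_card_fiber_le (by omega) _ (((filter_subset _ _).trans (filter_subset _ _)).trans
      (filter_subset _ _)) t (fun a ha => (mem_filter.1 ha).2)
      (fun a ha => (mem_filter.1 (mem_filter.1 (mem_filter.1 ha).1).1).2) fun S hS => ?_
    by_cases hFt : F t = 0
    · rw [eq_empty_of_forall_notMem (s := S)]
      · simp
      · intro P hP
        obtain ⟨-, a, ha, -⟩ := hS P hP
        rw [mem_filter, mem_filter] at ha
        rw [ha.2] at ha
        exact ha.1.2 hFt
    · refine hH₀ H (by omega) _ (mem_tupleBox.1 ht _) _ (mem_tupleBox.1 ht _) _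
        (mem_tupleBox.1 ht _) hFt S fun P hP => ?_
      obtain ⟨hl, a, ha, haP⟩ := hS P hP
      have := hF a P haP
      rw [(mem_filter.1 ha).2] at this
      exact ⟨hl, this⟩
  rw [hsplit, mul_add]
  calc _ ≤ (2 * H) ^ ((e + 3 + 1) * Module.finrank ℚ K) +
          (2 * Module.finrank ℚ K + 1) * (2 * H) ^ ((e + 3 + 1) * Module.finrank ℚ K) :=
        Nat.add_le_add h0 h1
    _ = _ := by ring

open Classical in
-- A prime that is not large has proportion `O(N ^ 2 / N ^ (d + 1))`, and `d ≥ 3` makes this `O(1 /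
-- N ^ 2)`.
theorem card_not_isLarge_le {d H : ℕ} (hd : 3 ≤ d) (S : Finset (HeightOneSpectrum (𝓞 K)))
    {δ : ℝ} (hδ : ∀ T : Finset (HeightOneSpectrum (𝓞 K)), Disjoint T S →
      ∑ P ∈ T, ((Ideal.absNorm P.asIdeal : ℝ) ^ 2)⁻¹ ≤ δ) :
    (#{a ∈ tupleBox E (d + 1) H | ∃ P ∉ S, ¬ IsLarge H P ∧ a ∈ localSet d P.asIdeal} : ℝ) ≤
      δ * (4 * H) ^ ((d + 1) * Module.finrank ℚ K) := by
  set B := {a ∈ tupleBox E (d + 1) H | ∃ P ∉ S, ¬ IsLarge H P ∧ a ∈ localSet d P.asIdeal}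
  have hB : ∀ a ∈ B, ∃ P ∉ S, ¬ IsLarge H P ∧ a ∈ localSet d P.asIdeal :=
    fun a ha => (mem_filter.1 ha).2
  rcases B.eq_empty_or_nonempty with h | ⟨a₀, ha₀⟩
  · have hδ0 : 0 ≤ δ := by simpa using hδ ∅ (disjoint_empty_left _)
    rw [h, card_empty, Nat.cast_zero]
    positivity
  have : Nonempty (HeightOneSpectrum (𝓞 K)) := ⟨(hB a₀ ha₀).choose⟩
  choose! p hp using hB
  have hcard (P : HeightOneSpectrum (𝓞 K)) (hP : P ∈ B.image p) :
      (#{a ∈ tupleBox E (d + 1) H | a ∈ localSet d P.asIdeal} : ℝ) ≤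
        ((Ideal.absNorm P.asIdeal : ℝ) ^ 2)⁻¹ * (4 * H) ^ ((d + 1) * Module.finrank ℚ K) := by
    obtain ⟨b, hb, rfl⟩ := mem_image.1 hP
    have hnl := (hp b hb).2.1
    simp only [IsLarge, not_forall, not_not] at hnl
    obtain ⟨q, hq, hqH, hqP⟩ := hnl
    have h := card_tupleBox_filter_localSet_le (E := E) (d := d) (p b) hq hqH hqP
    have h1 := one_lt_absNorm (p b)
    set N := Ideal.absNorm (p b).asIdeal
    have hN : (0 : ℝ) < N := by exact_mod_cast (by omega : 0 < N)
    rw [inv_mul_eq_div, le_div_iff₀' (by positivity)]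
    have h2 : (N : ℝ) ^ (d + 1) * #{a ∈ tupleBox E (d + 1) H | a ∈ localSet d (p b).asIdeal} ≤
        N ^ 2 * (4 * H) ^ ((d + 1) * Module.finrank ℚ K) := by exact_mod_cast h
    refine le_of_mul_le_mul_left (le_trans ?_ h2) (by positivity : (0 : ℝ) < N ^ 2)
    rw [← mul_assoc, ← pow_add]
    exact mul_le_mul_of_nonneg_right
      (pow_le_pow_right₀ (by exact_mod_cast h1.le) (by omega)) (Nat.cast_nonneg _)
  calc (#B : ℝ) ≤ ∑ P ∈ B.image p,
          (#{a ∈ tupleBox E (d + 1) H | a ∈ localSet d P.asIdeal} : ℝ) := by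
        rw [← Nat.cast_sum]
        refine Nat.cast_le.2 ((card_le_card fun a ha => ?_).trans card_biUnion_le)
        exact mem_biUnion.2 ⟨p a, mem_image_of_mem p ha,
          mem_filter.2 ⟨(mem_filter.1 ha).1, (hp a ha).2.2⟩⟩
    _ ≤ ∑ P ∈ B.image p,
          ((Ideal.absNorm P.asIdeal : ℝ) ^ 2)⁻¹ * (4 * H) ^ ((d + 1) * Module.finrank ℚ K) :=
        sum_le_sum hcard
    _ ≤ _ := by
        rw [← sum_mul]
        gcongr
        refine hδ _ (Finset.disjoint_left.2 fun P hP => ?_)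
        obtain ⟨b, hb, rfl⟩ := mem_image.1 hP
        exact (hp b hb).1

open Classical Filter in
/-- For `d ≥ 3` the tuples which are shifted `P`-Eisenstein for some `P` outside a large finite set
of primes have small upper density. -/
theorem exists_eventually_card_le {d : ℕ} (hd : 3 ≤ d)
    (hsum : Summable fun P : HeightOneSpectrum (𝓞 K) => ((Ideal.absNorm P.asIdeal : ℝ) ^ 2)⁻¹)
    {ε : ℝ} (hε : 0 < ε) :
    ∃ S : Finset (HeightOneSpectrum (𝓞 K)), ∀ᶠ H : ℕ in atTop,
      (#{a ∈ tupleBox E (d + 1) H | ∃ P ∉ S, a ∈ localSet d P.asIdeal} : ℝ) ≤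
        ε * (2 * H) ^ ((d + 1) * Module.finrank ℚ K) := by
  obtain ⟨e, rfl⟩ : ∃ e, d = e + 3 := ⟨d - 3, by omega⟩
  set n := (e + 3 + 1) * Module.finrank ℚ K
  -- The factor `2 ^ n` absorbs the passage from `(4 * H) ^ n` to `(2 * H) ^ n`.
  obtain ⟨S, hS⟩ := summable_iff_vanishing_norm.1 hsum (ε / 2 / 2 ^ n) (by positivity)
  obtain ⟨H₀, hH₀⟩ := exists_forall_mul_card_isLarge_le E e
  set c := 2 * Module.finrank ℚ K + 2
  refine ⟨S, ?_⟩
  have hlim : Tendsto (fun H : ℕ => (c : ℝ) / (2 * H)) atTop (nhds 0) :=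
    tendsto_const_nhds.div_atTop
      (tendsto_natCast_atTop_atTop.const_mul_atTop (by norm_num : (0 : ℝ) < 2))
  filter_upwards [eventually_ge_atTop H₀, eventually_gt_atTop 0,
    hlim.eventually_le_const (half_pos hε)] with H h1 h2 h3
  have hH : (0 : ℝ) < 2 * H := by positivity
  have hA := card_not_isLarge_le (E := E) (H := H) hd S (δ := ε / 2 / 2 ^ n) fun T hT =>
    (le_abs_self _).trans (hS T hT).le
  have hB : (#{a ∈ tupleBox E (e + 3 + 1) H |
      ∃ P : HeightOneSpectrum (𝓞 K), IsLarge H P ∧ a ∈ localSet (e + 3) P.asIdeal} : ℝ) ≤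
        ε / 2 * (2 * H) ^ n := by
    have := hH₀ H h1
    have h4 : (2 * H : ℝ) * #{a ∈ tupleBox E (e + 3 + 1) H |
      ∃ P : HeightOneSpectrum (𝓞 K), IsLarge H P ∧ a ∈ localSet (e + 3) P.asIdeal} ≤
        c * (2 * H) ^ n := by exact_mod_cast this
    rw [← le_div_iff₀' hH] at h4
    refine h4.trans ?_
    rw [mul_div_right_comm]
    gcongr
  have hsub : {a ∈ tupleBox E (e + 3 + 1) H | ∃ P ∉ S, a ∈ localSet (e + 3) P.asIdeal} ⊆
      {a ∈ tupleBox E (e + 3 + 1) H | ∃ P ∉ S, ¬ IsLarge H P ∧ a ∈ localSet (e + 3) P.asIdeal} ∪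
      {a ∈ tupleBox E (e + 3 + 1) H |
        ∃ P : HeightOneSpectrum (𝓞 K), IsLarge H P ∧ a ∈ localSet (e + 3) P.asIdeal} := by
    intro a ha
    obtain ⟨ha, P, hP, haP⟩ := mem_filter.1 ha
    rw [mem_union, mem_filter, mem_filter]
    by_cases hl : IsLarge H P
    · exact Or.inr ⟨ha, P, hl, haP⟩
    · exact Or.inl ⟨ha, P, hP, hl, haP⟩
  calc _ ≤ _ := Nat.cast_le.2 ((card_le_card hsub).trans (card_union_le _ _))
    _ ≤ ε / 2 / 2 ^ n * (4 * H) ^ n + ε / 2 * (2 * H) ^ n := by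
        rw [Nat.cast_add]; exact add_le_add hA hB
    _ = _ := by
        rw [show (4 * H : ℝ) = 2 * (2 * H) by ring, mul_pow 2 (2 * H : ℝ)]
        field_simp
        ring

end Tail

/-! ### Sums over primes from the pole of the Dedekind zeta function. -/

section Sums

open Finset IsDedekindDomain Filter Topology

variable {K : Type*} [Field K] [NumberField K]

theorem exists_eq_prod_pow {I : Ideal (𝓞 K)} (hI : I ≠ ⊥) (S : Finset (HeightOneSpectrum (𝓞 K)))
    (hS : ∀ P : HeightOneSpectrum (𝓞 K), P.asIdeal ∣ I → P ∈ S) :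
    ∃ v : HeightOneSpectrum (𝓞 K) → ℕ, I = ∏ P ∈ S, P.asIdeal ^ v P := by
  classical
  refine ⟨fun P => (Associates.mk P.asIdeal).count (Associates.mk I).factors, ?_⟩
  conv_lhs => rw [← Ideal.finprod_heightOneSpectrum_factorization hI]
  refine finprod_eq_prod_of_mulSupport_subset _ fun P hP => hS P ?_
  rw [← Associates.count_ne_zero_iff_dvd hI P.irreducible]
  intro h
  exact hP (by change P.asIdeal ^ _ = 1; rw [h, pow_zero])

theorem inv_absNorm_le_half (P : HeightOneSpectrum (𝓞 K)) :
    (Ideal.absNorm P.asIdeal : ℝ)⁻¹ ≤ 1 / 2 := by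
  rw [inv_eq_one_div]
  exact one_div_le_one_div_of_le (by norm_num) (by exact_mod_cast one_lt_absNorm P)

/-- For `0 ≤ x ≤ 1 / 2` the geometric sum is at most `1 / (1 - x) ≤ 1 + 2 * x ≤ exp (2 * x)`. -/
theorem sum_pow_inv_le_exp (P : HeightOneSpectrum (𝓞 K)) (m : ℕ) :
    ∑ i ∈ range m, (Ideal.absNorm P.asIdeal : ℝ)⁻¹ ^ i ≤
      Real.exp (2 * (Ideal.absNorm P.asIdeal : ℝ)⁻¹) := by
  have h1 := inv_absNorm_le_half P
  have h0 : 0 ≤ (Ideal.absNorm P.asIdeal : ℝ)⁻¹ := by positivity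
  set x := (Ideal.absNorm P.asIdeal : ℝ)⁻¹
  have h2 : ∑ i ∈ range m, x ^ i ≤ (1 - x)⁻¹ := by
    rw [← tsum_geometric_of_lt_one h0 (by linarith)]
    exact (summable_geometric_of_lt_one h0 (by linarith)).sum_le_tsum _ fun _ _ => by positivity
  refine h2.trans ((?_ : _ ≤ 1 + 2 * x).trans (by linarith [Real.add_one_le_exp (2 * x)]))
  rw [inv_le_iff_one_le_mul₀ (by linarith)]
  nlinarith

/-- A finite form of the upper bound in the Euler product of the Dedekind zeta function. -/
theorem exists_sum_inv_absNorm_le (A : Finset (Ideal (𝓞 K))) (hA : ∀ I ∈ A, I ≠ ⊥) :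
    ∃ S : Finset (HeightOneSpectrum (𝓞 K)), ∑ I ∈ A, (Ideal.absNorm I : ℝ)⁻¹ ≤
      Real.exp (2 * ∑ P ∈ S, (Ideal.absNorm P.asIdeal : ℝ)⁻¹) := by
  classical
  have hfin : (⋃ I ∈ A, {P : HeightOneSpectrum (𝓞 K) | P.asIdeal ∣ I}).Finite :=
    A.finite_toSet.biUnion fun I hI => Ideal.finite_factors (hA I hI)
  set S := hfin.toFinset
  have hS : ∀ I ∈ A, ∃ v : HeightOneSpectrum (𝓞 K) → ℕ, I = ∏ P ∈ S, P.asIdeal ^ v P :=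
    fun I hI => exists_eq_prod_pow (hA I hI) S fun P hP =>
      hfin.mem_toFinset.2 (Set.mem_biUnion hI hP)
  choose! v hv using hS
  let m := (A.sup fun I => S.sup fun P => v I P) + 1
  have hm : ∀ I ∈ A, ∀ P ∈ S, v I P < m := fun I hI P hP =>
    Nat.lt_succ_of_le ((le_sup (f := fun P => v I P) hP).trans
      (le_sup (f := fun I => S.sup fun P => v I P) hI))
  refine ⟨S, ?_⟩
  let w (I : Ideal (𝓞 K)) : S → ℕ := fun P => v I P
  have hprod : ∀ I ∈ A, I = ∏ P : S, P.1.asIdeal ^ w I P := fun I hI => by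
    rw [prod_coe_sort S fun P => P.asIdeal ^ v I P]
    exact hv I hI
  have hnorm : ∀ I ∈ A, (Ideal.absNorm I : ℝ)⁻¹ =
      ∏ P : S, (Ideal.absNorm P.1.asIdeal : ℝ)⁻¹ ^ w I P := fun I hI => by
    conv_lhs => rw [hprod I hI, map_prod]
    simp
  have hinj : Set.InjOn w A := fun I hI J hJ h => by rw [hprod I hI, hprod J hJ, h]
  calc ∑ I ∈ A, (Ideal.absNorm I : ℝ)⁻¹
      = ∑ f ∈ A.image w, ∏ P : S, (Ideal.absNorm P.1.asIdeal : ℝ)⁻¹ ^ f P := by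
        rw [sum_image hinj]
        exact sum_congr rfl hnorm
    _ ≤ ∑ f ∈ Fintype.piFinset fun _ : S => range m,
          ∏ P : S, (Ideal.absNorm P.1.asIdeal : ℝ)⁻¹ ^ f P := by
        refine sum_le_sum_of_subset_of_nonneg (fun f hf => ?_) fun _ _ _ => by positivity
        obtain ⟨I, hI, rfl⟩ := mem_image.1 hf
        exact Fintype.mem_piFinset.2 fun P => mem_range.2 (hm I hI P P.2)
    _ = ∏ P : S, ∑ i ∈ range m, (Ideal.absNorm P.1.asIdeal : ℝ)⁻¹ ^ i :=
        (prod_univ_sum (fun _ : S => range m)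
          fun P i => (Ideal.absNorm P.1.asIdeal : ℝ)⁻¹ ^ i).symm
    _ ≤ ∏ P : S, Real.exp (2 * (Ideal.absNorm P.1.asIdeal : ℝ)⁻¹) :=
        prod_le_prod (fun _ _ => by positivity) fun P _ => sum_pow_inv_le_exp P.1 m
    _ = _ := by
        rw [prod_coe_sort S fun P => Real.exp (2 * (Ideal.absNorm P.asIdeal : ℝ)⁻¹), mul_sum,
          Real.exp_sum]

variable (K) in
/-- The number of ideals of norm `n`. -/
noncomputable def idealCount (n : ℕ) : ℕ := Nat.card {I : Ideal (𝓞 K) // Ideal.absNorm I = n}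

theorem sum_comp_absNorm (A : Finset (Ideal (𝓞 K))) (n : ℕ)
    (hA : ∀ I, I ∈ A ↔ Ideal.absNorm I ∈ Icc 1 n) (g : ℕ → ℝ) :
    ∑ m ∈ Icc 1 n, (idealCount K m : ℝ) * g m = ∑ I ∈ A, g (Ideal.absNorm I) := by
  classical
  rw [← sum_fiberwise_of_maps_to (s := A) (t := Icc 1 n) (g := Ideal.absNorm)
    fun I hI => (hA I).1 hI]
  refine sum_congr rfl fun m hm => ?_
  rw [sum_congr rfl (g := fun _ => g m) (fun I hI => by rw [(mem_filter.1 hI).2]), sum_const,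
    nsmul_eq_mul, idealCount]
  congr 2
  rw [← Nat.card_eq_finsetCard]
  refine Nat.card_congr (Equiv.subtypeEquivRight fun I => ?_)
  rw [mem_filter, hA]
  exact ⟨fun h => ⟨h ▸ hm, h⟩, fun h => h.2⟩

theorem dedekindZeta_eq (s : ℂ) : dedekindZeta K s = LSeries (fun n => (idealCount K n : ℂ)) s :=
  rfl

/-- Convergence at `1` would bound the zeta function on `s > 1`, so `(s - 1) * ζ(s)` would tend to
`0`, against its nonzero residue. -/
theorem not_summable_idealCount : ¬ Summable fun n : ℕ => (idealCount K n : ℝ) * (n : ℝ)⁻¹ := by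
  intro hs
  have hbound : ∀ s : ℝ, 1 < s → ‖dedekindZeta K s‖ ≤ ∑' n, (idealCount K n : ℝ) * (n : ℝ)⁻¹ := by
    intro s h1
    have hterm (n : ℕ) : ‖LSeries.term (fun n => (idealCount K n : ℂ)) s n‖ ≤
        (idealCount K n : ℝ) * (n : ℝ)⁻¹ := by
      rw [LSeries.norm_term_eq]
      split_ifs with hn
      · positivity
      · rw [← div_eq_mul_inv, Complex.norm_natCast, Complex.ofReal_re]
        have hn1 : (1 : ℝ) ≤ n := by exact_mod_cast Nat.one_le_iff_ne_zero.2 hn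
        gcongr
        exact Real.self_le_rpow_of_one_le hn1 h1.le
    rw [dedekindZeta_eq, LSeries]
    exact tsum_of_norm_bounded hs.hasSum hterm
  have h0 : Tendsto (fun s : ℝ => ((s : ℂ) - 1) * dedekindZeta K s) (𝓝[>] 1) (𝓝 0) := by
    have h1 : Tendsto (fun s : ℝ => ((s : ℂ) - 1)) (𝓝[>] 1) (𝓝 0) := by
      refine tendsto_nhdsWithin_of_tendsto_nhds ?_
      have : Continuous fun s : ℝ => ((s : ℂ) - 1) := by fun_prop
      simpa using this.tendsto 1
    refine h1.zero_mul_isBoundedUnder_le (isBoundedUnder_of_eventually_le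
      (a := ∑' n, (idealCount K n : ℝ) * (n : ℝ)⁻¹) ?_)
    filter_upwards [self_mem_nhdsWithin] with s hs using hbound s hs
  have := tendsto_nhds_unique h0 (tendsto_sub_one_mul_dedekindZeta_nhdsGT K)
  exact dedekindZeta_residue_ne_zero K (by exact_mod_cast this.symm)

theorem summable_idealCount : Summable fun n : ℕ => (idealCount K n : ℝ) * ((n : ℝ) ^ 2)⁻¹ := by
  have hne : ∀ᶠ s : ℝ in 𝓝[>] 1, ((s : ℂ) - 1) * dedekindZeta K s ≠ 0 :=
    (tendsto_sub_one_mul_dedekindZeta_nhdsGT K).eventually_ne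
      (by exact_mod_cast dedekindZeta_residue_ne_zero K)
  obtain ⟨s, h1, h2⟩ := (hne.and (Ioo_mem_nhdsGT (show (1 : ℝ) < 2 by norm_num))).exists
  -- A divergent series has the default value `0`, so a nonzero zeta value at some `1 < s < 2`
  -- certifies summability there, and hence at `2`.
  have hs : LSeriesSummable (fun n => (idealCount K n : ℂ)) s := by
    by_contra h
    exact h1 (by rw [dedekindZeta_eq, LSeries, tsum_eq_zero_of_not_summable h, mul_zero])
  have h3 := (hs.of_re_le_re (s' := 2) (by simpa using h2.2.le)).norm
  refine h3.congr fun n => ?_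
  rw [LSeries.norm_term_eq]
  split_ifs with hn
  · simp [hn]
  · simp [div_eq_mul_inv]

theorem summable_inv_absNorm_sq :
    Summable fun P : HeightOneSpectrum (𝓞 K) => ((Ideal.absNorm P.asIdeal : ℝ) ^ 2)⁻¹ := by
  classical
  refine summable_of_sum_le (c := ∑' n : ℕ, (idealCount K n : ℝ) * ((n : ℝ) ^ 2)⁻¹)
    (fun _ => by positivity) fun A => ?_
  calc ∑ P ∈ A, ((Ideal.absNorm P.asIdeal : ℝ) ^ 2)⁻¹
      = ∑ I ∈ A.image HeightOneSpectrum.asIdeal, ((Ideal.absNorm I : ℝ) ^ 2)⁻¹ :=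
        (sum_image (f := fun I => ((Ideal.absNorm I : ℝ) ^ 2)⁻¹)
          fun P _ Q _ h => HeightOneSpectrum.ext h).symm
    _ ≤ ∑ n ∈ Icc 1 ((A.image HeightOneSpectrum.asIdeal).sup Ideal.absNorm),
          (idealCount K n : ℝ) * ((n : ℝ) ^ 2)⁻¹ := by
        set n := (A.image HeightOneSpectrum.asIdeal).sup Ideal.absNorm
        have hfin := Ideal.finite_setOfPred_absNorm_le (S := 𝓞 K) n
        rw [sum_comp_absNorm ((hfin.toFinset).filter fun I => 1 ≤ Ideal.absNorm I) n
          (by simp [and_comm]) fun n => ((n : ℝ) ^ 2)⁻¹]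
        refine sum_le_sum_of_subset_of_nonneg (fun I hI => ?_) fun _ _ _ => by positivity
        rw [mem_filter, Set.Finite.mem_toFinset]
        refine ⟨le_sup (f := Ideal.absNorm) hI, ?_⟩
        obtain ⟨P, -, rfl⟩ := mem_image.1 hI
        exact (one_lt_absNorm P).le
    _ ≤ _ := summable_idealCount.sum_le_tsum _ fun _ _ => by positivity

/-- Otherwise the Euler product bound would keep the partial sums of `1 / N(I)` over nonzero ideals
bounded. -/
theorem not_summable_inv_absNorm :
    ¬ Summable fun P : HeightOneSpectrum (𝓞 K) => (Ideal.absNorm P.asIdeal : ℝ)⁻¹ := by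
  classical
  intro hs
  refine not_summable_idealCount (K := K) (summable_of_sum_range_le
    (c := Real.exp (2 * ∑' P : HeightOneSpectrum (𝓞 K), (Ideal.absNorm P.asIdeal : ℝ)⁻¹))
    (fun _ => by positivity) fun n => ?_)
  have hfin := Ideal.finite_setOfPred_absNorm_le (S := 𝓞 K) n
  set A := (hfin.toFinset).filter fun I => 1 ≤ Ideal.absNorm I
  have hA : ∀ I, I ∈ A ↔ Ideal.absNorm I ∈ Icc 1 n := by simp [A, and_comm]
  calc ∑ m ∈ range n, (idealCount K m : ℝ) * (m : ℝ)⁻¹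
      ≤ ∑ m ∈ Icc 1 n, (idealCount K m : ℝ) * (m : ℝ)⁻¹ := by
        -- The term `m = 0`, which counts the zero ideal, vanishes since `0⁻¹ = 0`.
        rw [← sum_filter_of_ne (p := fun m => 1 ≤ m)]
        · refine sum_le_sum_of_subset_of_nonneg (fun m hm => ?_) fun _ _ _ => by positivity
          rw [mem_filter, mem_range] at hm
          exact mem_Icc.2 ⟨hm.2, hm.1.le⟩
        · intro m _ hm
          refine Nat.one_le_iff_ne_zero.2 fun h => hm ?_
          simp [h]
    _ = ∑ I ∈ A, (Ideal.absNorm I : ℝ)⁻¹ := sum_comp_absNorm A n hA fun m => (m : ℝ)⁻¹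
    _ ≤ _ := by
        obtain ⟨S, hS⟩ := exists_sum_inv_absNorm_le A fun I hI h => by
          have := (mem_Icc.1 ((hA I).1 hI)).1
          rw [h, Ideal.absNorm_bot] at this
          omega
        refine hS.trans (Real.exp_le_exp.2 ?_)
        have := hs.sum_le_tsum S fun _ _ => by positivity
        linarith

end Sums

/-! ### The infinite product and the passage to the limit. -/

section Main

open Finset IsDedekindDomain Filter Topology

/-- Unconditional convergence of a product with factors in `[0, 1]`. -/
theorem hasProd_iInf_of_mem_Icc {ι : Type*} {f : ι → ℝ} (h0 : ∀ i, 0 ≤ f i) (h1 : ∀ i, f i ≤ 1) :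
    HasProd f (⨅ s : Finset ι, ∏ i ∈ s, f i) := by
  classical
  refine tendsto_atTop_ciInf (fun s t hst => ?_) ⟨0, ?_⟩
  · rw [← prod_sdiff hst]
    exact mul_le_of_le_one_left (prod_nonneg fun i _ => h0 i)
      (prod_le_one (fun i _ => h0 i) fun i _ => h1 i)
  · rintro _ ⟨s, rfl⟩
    exact prod_nonneg fun i _ => h0 i

variable {K : Type*} [Field K] [NumberField K]

theorem factor_mem_Icc (d : ℕ) (hd : 2 ≤ d) (P : HeightOneSpectrum (𝓞 K)) :
    0 ≤ (1 - ((Ideal.absNorm P.asIdeal : ℝ) - 1) ^ 2 / (Ideal.absNorm P.asIdeal : ℝ) ^ (d + 1)) ∧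
    (1 - ((Ideal.absNorm P.asIdeal : ℝ) - 1) ^ 2 / (Ideal.absNorm P.asIdeal : ℝ) ^ (d + 1)) ≤ 1 := by
  have hN : (1 : ℝ) < Ideal.absNorm P.asIdeal := by exact_mod_cast one_lt_absNorm P
  set N : ℝ := ((Ideal.absNorm P.asIdeal : ℕ) : ℝ)
  constructor
  · rw [sub_nonneg]
    refine div_le_one_of_le₀ ?_ (by positivity)
    calc (N - 1) ^ 2 ≤ N ^ 2 := pow_le_pow_left₀ (by linarith) (by linarith) 2
      _ ≤ N ^ (d + 1) := pow_le_pow_right₀ hN.le (by omega)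
  · have : 0 ≤ (N - 1) ^ 2 / N ^ (d + 1) := by positivity
    linarith

theorem hasProd_factor (d : ℕ) (hd : 2 ≤ d) :
    HasProd (fun P : HeightOneSpectrum (𝓞 K) =>
      (1 - ((Ideal.absNorm P.asIdeal : ℝ) - 1) ^ 2 / (Ideal.absNorm P.asIdeal : ℝ) ^ (d + 1)))
      (∏' P : HeightOneSpectrum (𝓞 K),
        (1 - ((Ideal.absNorm P.asIdeal : ℝ) - 1) ^ 2 / (Ideal.absNorm P.asIdeal : ℝ) ^ (d + 1))) :=
  (hasProd_iInf_of_mem_Icc (fun P => (factor_mem_Icc d hd P).1)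
    fun P => (factor_mem_Icc d hd P).2).multipliable.hasProd

variable (K) in
-- For `N ≥ 2` one has `(N - 1) ^ 2 / N ^ 3 ≥ 1 / (4 * N)`, so by `1 - x ≤ exp (-x)` the partial
-- products are at most `exp (-∑ 1 / (4 * N))`, which tends to `0`.
theorem tprod_factor_two :
    ∏' P : HeightOneSpectrum (𝓞 K), (1 - ((Ideal.absNorm P.asIdeal : ℝ) - 1) ^ 2 /
      (Ideal.absNorm P.asIdeal : ℝ) ^ (2 + 1)) = 0 := by
  have hpos : ∀ P : HeightOneSpectrum (𝓞 K), 0 ≤ (Ideal.absNorm P.asIdeal : ℝ)⁻¹ / 4 :=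
    fun _ => by positivity
  have hns : ¬ Summable fun P : HeightOneSpectrum (𝓞 K) => (Ideal.absNorm P.asIdeal : ℝ)⁻¹ / 4 :=
    fun h => not_summable_inv_absNorm (K := K) (by simpa using h.mul_right 4)
  have hdiv : Tendsto (fun S : Finset (HeightOneSpectrum (𝓞 K)) =>
      ∑ P ∈ S, (Ideal.absNorm P.asIdeal : ℝ)⁻¹ / 4) atTop atTop := by
    refine tendsto_atTop_atTop.2 fun b => ?_
    by_contra! h
    refine hns (summable_of_sum_le (c := b) hpos fun S => ?_)
    obtain ⟨T, hST, hT⟩ := h S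
    exact (sum_le_sum_of_subset_of_nonneg hST fun P _ _ => hpos P).trans hT.le
  have hexp := Real.tendsto_exp_neg_atTop_nhds_zero.comp hdiv
  refine tendsto_nhds_unique (hasProd_factor (K := K) 2 le_rfl) ?_
  refine squeeze_zero (fun S => prod_nonneg fun P _ => (factor_mem_Icc 2 le_rfl P).1)
    (fun S => ?_) hexp
  rw [Function.comp_apply, ← sum_neg_distrib, Real.exp_sum]
  refine prod_le_prod (fun P _ => (factor_mem_Icc 2 le_rfl P).1) fun P _ => ?_
  have hN : (2 : ℝ) ≤ Ideal.absNorm P.asIdeal := by exact_mod_cast one_lt_absNorm P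
  set N : ℝ := ((Ideal.absNorm P.asIdeal : ℕ) : ℝ)
  have h1 : N⁻¹ / 4 ≤ (N - 1) ^ 2 / N ^ (2 + 1) := by
    rw [le_div_iff₀ (by positivity)]
    have : N⁻¹ / 4 * N ^ (2 + 1) = N ^ 2 / 4 := by field_simp
    rw [this]
    nlinarith
  linarith [Real.add_one_le_exp (-(N⁻¹ / 4))]

variable {E : Module.Basis (Fin (Module.finrank ℚ K)) ℤ (𝓞 K)}

/-- The shifted Eisenstein tuples have density `1 - p` with respect to every basis, `p` being the
product of the local factors; for `d = 2` this needs `p = 0`, so that no tail estimate is used. -/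
theorem hasDensityWrt_shiftedEisenstein {d : ℕ} (hd : 2 ≤ d) {p : ℝ}
    (hp : HasProd (fun P : HeightOneSpectrum (𝓞 K) =>
      (1 - ((Ideal.absNorm P.asIdeal : ℝ) - 1) ^ 2 / (Ideal.absNorm P.asIdeal : ℝ) ^ (d + 1))) p)
    (hp' : p = 0 ∨ 3 ≤ d) :
    HasDensityWrt E (shiftedEisenstein K d) (1 - p) := by
  classical
  set f : HeightOneSpectrum (𝓞 K) → ℝ := fun P =>
    1 - ((Ideal.absNorm P.asIdeal : ℝ) - 1) ^ 2 / (Ideal.absNorm P.asIdeal : ℝ) ^ (d + 1)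
  set n := (d + 1) * Module.finrank ℚ K
  have hple (S : Finset (HeightOneSpectrum (𝓞 K))) : p ≤ ∏ P ∈ S, f P := by
    refine le_of_tendsto hp (eventually_atTop.2 ⟨S, fun T hT => ?_⟩)
    rw [← prod_sdiff hT]
    exact mul_le_of_le_one_left (prod_nonneg fun P _ => (factor_mem_Icc d hd P).1)
      (prod_le_one (fun P _ => (factor_mem_Icc d hd P).1) fun P _ => (factor_mem_Icc d hd P).2)
  let c (H : ℕ) : ℝ := #{a ∈ tupleBox E (d + 1) H | a ∈ shiftedEisenstein K d}
  let u (S : Finset (HeightOneSpectrum (𝓞 K))) (H : ℕ) : ℝ :=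
    #{a ∈ tupleBox E (d + 1) H | ∀ P ∈ S, a ∉ localSet d P.asIdeal}
  have hu (S) : Tendsto (fun H => u S H / (2 * (H : ℝ)) ^ n) atTop (𝓝 (∏ P ∈ S, f P)) := by
    have := hasDensityWrt_forall_notMem_localSet (E := E) hd S
    rw [HasDensityWrt] at this
    refine this.congr fun H => ?_
    rw [ncard_inter_box]
    simp only [u, n, Set.mem_ofPred_eq]
  have hmem (a : Fin (d + 1) → 𝓞 K) : a ∈ shiftedEisenstein K d ↔
      ∃ P : HeightOneSpectrum (𝓞 K), a ∈ localSet d P.asIdeal := by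
    rw [shiftedEisenstein_eq, Set.mem_iUnion]
  have hcompl (S) (H : ℕ) : (u S H : ℝ) +
      #{a ∈ tupleBox E (d + 1) H | ¬ ∀ P ∈ S, a ∉ localSet d P.asIdeal} = (2 * (H : ℝ)) ^ n := by
    have := card_filter_add_card_filter_not (s := tupleBox E (d + 1) H)
      (fun a => ∀ P ∈ S, a ∉ localSet d P.asIdeal)
    rw [card_tupleBox] at this
    simp only [u, n]
    exact_mod_cast this
  have hlow (S) (H : ℕ) : (2 * (H : ℝ)) ^ n - u S H ≤ c H := by
    rw [← hcompl S H, add_sub_cancel_left]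
    refine Nat.cast_le.2 (card_le_card fun a ha => ?_)
    rw [mem_filter] at ha ⊢
    refine ⟨ha.1, (hmem a).2 ?_⟩
    by_contra! h
    exact ha.2 fun P _ => h P
  have hup (S) (H : ℕ) : c H ≤ (2 * (H : ℝ)) ^ n - u S H +
      #{a ∈ tupleBox E (d + 1) H | ∃ P ∉ S, a ∈ localSet d P.asIdeal} := by
    rw [← hcompl S H, add_sub_cancel_left, ← Nat.cast_add]
    refine Nat.cast_le.2 (le_trans (card_le_card fun a ha => ?_) (card_union_le _ _))
    rw [mem_filter, hmem] at ha
    obtain ⟨ha, P, hP⟩ := ha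
    rw [mem_union, mem_filter, mem_filter]
    by_cases h : P ∈ S
    · exact Or.inl ⟨ha, fun h' => h' P h hP⟩
    · exact Or.inr ⟨ha, P, h, hP⟩
  have hcle (H : ℕ) : c H ≤ (2 * (H : ℝ)) ^ n := by
    have := card_le_card (filter_subset (fun a => a ∈ shiftedEisenstein K d) (tupleBox E (d + 1) H))
    rw [card_tupleBox] at this
    simp only [c, n]
    exact_mod_cast this
  rw [HasDensityWrt]
  simp only [ncard_inter_box]
  change Tendsto (fun H => c H / (2 * (H : ℝ)) ^ n) atTop (𝓝 (1 - p))
  rw [tendsto_order]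
  constructor
  · intro x hx
    obtain ⟨S, hS⟩ := (hp.eventually_lt_const (show p < 1 - x by linarith)).exists
    filter_upwards [(hu S).eventually_lt_const hS, eventually_gt_atTop 0] with H h1 h2
    have hH : (0 : ℝ) < (2 * (H : ℝ)) ^ n := by positivity
    rw [lt_div_iff₀ hH]
    rw [div_lt_iff₀ hH] at h1
    linarith [hlow S H]
  · intro x hx
    rcases hp' with rfl | hd3
    · filter_upwards with H
      exact lt_of_le_of_lt (div_le_one_of_le₀ (hcle H) (by positivity)) (by linarith)
    · obtain ⟨ε, hε, hεx⟩ : ∃ ε > 0, 1 - p + 2 * ε < x :=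
        ⟨(x - (1 - p)) / 3, by linarith, by linarith⟩
      -- One `ε` pays for the primes outside `S`, the other for the limit of the count over `S`,
      -- whose value is at least `p`.
      obtain ⟨S, hS⟩ := exists_eventually_card_le (E := E) hd3 summable_inv_absNorm_sq hε
      filter_upwards [hS, (hu S).eventually_const_lt
        (show p - ε < ∏ P ∈ S, f P by linarith [hple S]), eventually_gt_atTop 0] with H h1 h2 h3
      have hH : (0 : ℝ) < (2 * (H : ℝ)) ^ n := by positivity
      rw [lt_div_iff₀ hH] at h2
      rw [div_lt_iff₀ hH]
      calc c H ≤ _ := hup S H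
        _ ≤ (2 * (H : ℝ)) ^ n - (p - ε) * (2 * (H : ℝ)) ^ n + ε * (2 * (H : ℝ)) ^ n := by
          gcongr
        _ = (1 - p + 2 * ε) * (2 * (H : ℝ)) ^ n := by ring
        _ < _ := mul_lt_mul_of_pos_right hεx hH

end Main

end EisensteinDensity

theorem corollary4p7 (K : Type*) [Field K] [NumberField K] (d : ℕ) (hd : 2 ≤ d) :
    Multipliable (fun P : IsDedekindDomain.HeightOneSpectrum (𝓞 K) =>
      (1 - ((Ideal.absNorm P.asIdeal : ℝ) - 1) ^ 2 / (Ideal.absNorm P.asIdeal : ℝ) ^ (d + 1) : ℝ)) ∧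
    EisensteinDensity.HasDensity (EisensteinDensity.shiftedEisenstein K d)
      (1 - ∏' P : IsDedekindDomain.HeightOneSpectrum (𝓞 K),
        (1 - ((Ideal.absNorm P.asIdeal : ℝ) - 1) ^ 2 /
          (Ideal.absNorm P.asIdeal : ℝ) ^ (d + 1) : ℝ)) ∧
    (d = 2 → EisensteinDensity.HasDensity (EisensteinDensity.shiftedEisenstein K d) 1) := by
  have hprod := EisensteinDensity.hasProd_factor (K := K) d hd
  have hzero : d = 2 → ∏' P : IsDedekindDomain.HeightOneSpectrum (𝓞 K),
      (1 - ((Ideal.absNorm P.asIdeal : ℝ) - 1) ^ 2 /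
        (Ideal.absNorm P.asIdeal : ℝ) ^ (d + 1) : ℝ) = 0 := by
    rintro rfl
    exact EisensteinDensity.tprod_factor_two K
  have hdens : EisensteinDensity.HasDensity (EisensteinDensity.shiftedEisenstein K d) _ := fun E =>
    EisensteinDensity.hasDensityWrt_shiftedEisenstein (E := E) hd hprod
      ((Nat.eq_or_lt_of_le hd).imp (fun h => hzero h.symm) id)
  refine ⟨hprod.multipliable, hdens, fun h => ?_⟩
  rwa [hzero h, sub_zero] at hdens
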